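/- Notation. Let $q$ be an indeterminate. For a field element $Q\neq 0,1$, $m\in\mathbb Z$ and $n,k\in\mathbb N$ put $[m]_Q=\frac{1-Q^m}{1-Q}$, $[n]_Q!=[n]_Q[n-1]_Q\cdots[1]_Q$ and $\left[{n\atop k}\right]_Q=\frac{[n]_Q[n-1]_Q\cdots[n-k+1]_Q}{[k]_Q!}$. A congruence $x\equiv y\pmod M$ between rational functions (resp. rational numbers) means that $x,y$ have a common denominator in $\mathbb Q[q]$ (resp. $\mathbb Z$) coprime to $M$ and that the corresponding numerators are congruent modulo $M$. All sums run over the integers $k$ in the given residue class; only the terms with $0\le k\le n$ are non-zero. The convention $0^0=1$ is used. Let $p\ge 5$ be a prime, $\alpha\ge 1$, $n,l\ge 0$ and $r$ integers, and put $N=\lfloor n/p^\alpha\rfloor$. (1) For $Q=q^{p^{\alpha}}$, and likewise for $Q=q^{p^{\alpha+1}}$, $$\frac{[p]_{q^{p^\alpha}}^l}{[N]_{q^{p^\alpha}}!}\sum_{k\equiv r\,(p^\alpha)}(-1)^kq^{\binom{kp}2}\left[{pn\atop pk}\right]_q\Big[\frac{k-r}{p^\alpha}\Big]_{Q}^l\equiv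 \frac{[p]_{q^{p^\alpha}}^l}{[N]_{q^{p^\alpha}}!}\sum_{k\equiv r\,(p^\alpha)}(-1)^kq^{nk\binom p2+p\binom k2}\left[{n\atop k}\right]_{q^p}\Big[\frac{k-r}{p^\alpha}\Big]_{Q}^l$$ $$+\frac{(p^2-1)n\,[p]_{q^{p^\alpha}}^l}{24\,[N]_{q^{p^\alpha}}!}\sum_{k\equiv r\,(p^\alpha)}(-1)^k(1-q^{kp})(1-q^{(n-k)p})\left[{n\atop k}\right]_{q^p}\Big[\frac{k-r}{p^\alpha}\Big]_{Q}^l\pmod{[p]_q^3}.$$ (2) Let $L(q)$ and $R(q)$ be the left and right sides of (1) for $Q=q^{p^{\alpha+1}}$, and let $$F(q)=\frac{[N]_{q^{p^\alpha}}!}{\prod_{j\ge\alpha+1}[p]_{q^{p^{j-1}}}^{\lfloor n/p^j\rfloor}}.$$ Then $F(q)\in\mathbb Z[q]$, and $F(1)=N!\,/\,p^{\sum_{j\ge\alpha+1}\lfloor n/p^j\rfloor}$ is an integer not divisible by $p$. With $e=pl\max(r,0)$, both $A(q)=q^{e}F(q)L(q)$ and $B(q)=q^{e}F(q)R(q)$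 lie in $\mathbb Z[q]$, and $A(q)-B(q)=[p]_q^3H(q)$ for some $H\in\mathbb Z[q]$. Moreover $A(1)=F(1)\lambda$ and $B(1)=F(1)\rho$, where $$\lambda=\frac{p^l}{N!}\sum_{k\equiv r\,(p^\alpha)}(-1)^k\binom{pn}{pk}\Big(\frac{k-r}{p^\alpha}\Big)^l,\qquad \rho=\frac{p^l}{N!}\sum_{k\equiv r\,(p^\alpha)}(-1)^k\binom{n}{k}\Big(\frac{k-r}{p^\alpha}\Big)^l.$$ (3) Consequently $\lambda\equiv\rho\pmod{p^3}$. For $\alpha=1$ this is the Sun–Davis conjecture $$\frac{p^l}{\lfloor n/p\rfloor!}\sum_{k\equiv r\,(p)}(-1)^k\binom{pn}{pk}\Big(\frac{k-r}{p}\Big)^l\equiv\frac{p^l}{\lfloor n/p\rfloor!}\sum_{k\equiv r\,(p)}(-1)^k\binom{n}{k}\Big(\frac{k-r}{p}\Big)^l\pmod{p^3}.$$ -/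

import Mathlib

noncomputable section

/-- Congruence of fractions: `x ≡ y (mod M)` for `x, y` in a field `K` containing the domain `A`.
It means that `x` and `y` can be written with a common denominator coprime to `M`, with numerators
congruent modulo `M`; that is, `x` and `y` lie in the localization of `A` at the elements coprime
to `M`, and `x - y` is a multiple of `M` there. -/
def FracCongr {A K : Type*} [CommRing A] [Field K] [Algebra A K] (M : A) (x y : K) : Prop :=
  ∃ a b c : A, c ≠ 0 ∧ IsCoprime c M ∧
    x = algebraMap A K a / algebraMap A K c ∧ y = algebraMap A K b / algebraMap A K c ∧ M ∣ a - b

/-- The `q`-integer `[m]_q = (1 - q^m) / (1 - q)`, `m ∈ ℤ` (used for `q ≠ 0, 1`). -/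
def qInt {K : Type*} [Field K] (q : K) (m : ℤ) : K := (1 - q ^ m) / (1 - q)

/-- The `q`-factorial `[n]_q! = [n]_q [n-1]_q ⋯ [1]_q`. -/
def qFact {K : Type*} [Field K] (q : K) (n : ℕ) : K :=
  ∏ i ∈ Finset.range n, qInt q ((i : ℤ) + 1)

/-- The `q`-binomial coefficient
`([n]_q [n-1]_q ⋯ [n-k+1]_q) / ([k]_q [k-1]_q ⋯ [1]_q)`. -/
def qBinom {K : Type*} [Field K] (q : K) (n k : ℕ) : K :=
  (∏ i ∈ Finset.range k, qInt q ((n : ℤ) - (i : ℤ))) / qFact q k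

/-- The `k ∈ {0, …, n}` with `k ≡ r (mod c)`. All other `k ≡ r (mod c)` contribute `0` to the sums
below, since their binomial coefficients vanish. -/
def lacunary (n c : ℕ) (r : ℤ) : Finset ℕ :=
  (Finset.range (n + 1)).filter (fun k => (k : ℤ) ≡ r [ZMOD (c : ℤ)])

/-- The variable `q` of the field `ℚ(q)`. -/
def qVar : RatFunc ℚ := RatFunc.X

/-- The polynomial `[p]_q = 1 + q + ⋯ + q^(p-1)`, over a coefficient ring `R`. -/
def qIntPoly (R : Type*) [CommRing R] (p : ℕ) : Polynomial R :=
  ∑ i ∈ Finset.range p, Polynomial.X ^ i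

/-- The inclusion of `ℤ[q]` in `ℚ(q)`. -/
def toRatFunc (f : Polynomial ℤ) : RatFunc ℚ :=
  algebraMap (Polynomial ℚ) (RatFunc ℚ) (f.map (Int.castRingHom ℚ))

/-- The factor `[p]_Q^l / [⌊n/p^α⌋]_Q!` with `Q = q^(p^α)`. -/
def normFactor (p α n l : ℕ) : RatFunc ℚ :=
  qInt (qVar ^ p ^ α) (p : ℤ) ^ l / qFact (qVar ^ p ^ α) (n / p ^ α)

/-- The weight `[(k-r)/p^α]_Q^l` with `Q = q^(p^β)`, for `k ≡ r (mod p^α)`. -/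
def weight (p α β l : ℕ) (r : ℤ) (k : ℕ) : RatFunc ℚ :=
  qInt (qVar ^ p ^ β) (((k : ℤ) - r) / ((p ^ α : ℕ) : ℤ)) ^ l

/-- The left side of the `q`-congruence. -/
def qLeft (p α β n l : ℕ) (r : ℤ) : RatFunc ℚ :=
  normFactor p α n l *
    ∑ k ∈ lacunary n (p ^ α) r,
      (-1) ^ k * qVar ^ (k * p).choose 2 * qBinom qVar (p * n) (p * k) * weight p α β l r k

/-- The right side of the `q`-congruence. -/
def qRight (p α β n l : ℕ) (r : ℤ) : RatFunc ℚ :=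
  normFactor p α n l *
    ∑ k ∈ lacunary n (p ^ α) r,
      (-1) ^ k * qVar ^ (n * k * p.choose 2 + p * k.choose 2) * qBinom (qVar ^ p) n k *
        weight p α β l r k
  + ((p : RatFunc ℚ) ^ 2 - 1) * (n : RatFunc ℚ) / 24 * normFactor p α n l *
    ∑ k ∈ lacunary n (p ^ α) r,
      (-1) ^ k * (1 - qVar ^ (k * p)) * (1 - qVar ^ ((n - k) * p)) * qBinom (qVar ^ p) n k *
        weight p α β l r k

/-- `F(q) = [⌊n/p^α⌋]_{q^(p^α)}! / ∏_{j ≥ α+1} [p]_{q^(p^(j-1))}^⌊n/p^j⌋`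
(the exponent is `0` when `j > n`). -/
def clearFactor (p α n : ℕ) : RatFunc ℚ :=
  qFact (qVar ^ p ^ α) (n / p ^ α) /
    ∏ j ∈ Finset.Icc (α + 1) n, qInt (qVar ^ p ^ (j - 1)) (p : ℤ) ^ (n / p ^ j)

/-- `p^l / ⌊n/p^α⌋! · ∑_{k ≡ r (mod p^α)} (-1)^k (pn choose pk) ((k-r)/p^α)^l`. -/
def sdLeft (p α n l : ℕ) (r : ℤ) : ℚ :=
  (p : ℚ) ^ l / ((n / p ^ α).factorial : ℚ) *
    ∑ k ∈ lacunary n (p ^ α) r,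
      (-1) ^ k * ((p * n).choose (p * k) : ℚ) * (((k : ℚ) - (r : ℚ)) / (p : ℚ) ^ α) ^ l

/-- `p^l / ⌊n/p^α⌋! · ∑_{k ≡ r (mod p^α)} (-1)^k (n choose k) ((k-r)/p^α)^l`. -/
def sdRight (p α n l : ℕ) (r : ℤ) : ℚ :=
  (p : ℚ) ^ l / ((n / p ^ α).factorial : ℚ) *
    ∑ k ∈ lacunary n (p ^ α) r,
      (-1) ^ k * (n.choose k : ℚ) * (((k : ℚ) - (r : ℚ)) / (p : ℚ) ^ α) ^ l

end

/-! Let Φ_m be the m-th cyclotomic polynomial, so that [p] in base q^(p^(j-1)) is Φ_{p^j}(q).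

The q-congruence holds term by term, whatever the weights (`cyclotomic_pow_three_dvd`). After
removal of the factors with index divisible by p, the quotient of [pn, pk]_q by [n, k]_{q^p} is made
of blocks ∏_{0<t<p} (1 - y q^t) with y = q^(pj). Pairing t with p - t gives (1 - y q^t)(1 - y
q^(p-t)) = y (1 - q^t)(1 - q^(p-t)) + (1 - y)(1 - y q^p). The last product is divisible by Φ_p^2, so
modulo Φ_p^3 only its first-order contribution survives, and ∑_{0<t<p} 1/((1 - ζ^t)(1 - ζ^(p-t))) =
(p^2 - 1)/12 produces the constant (p^2 - 1)/24. The denominator [N]! does not vanish at ζ.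

Setting q = 1 needs more: [N]! contains factors Φ_{p^j} with j > α, each worth p at q = 1. They must
be shown to divide the sums. In base q^(p^(α+1)) the weight times [p] is (1 - q^(p(k-r)))/(1 -
q^(p^α)), so the weighted sums reduce to lacunary sums of c_k q^(pki). Over the group algebra of
ZMod (p^α) or ZMod (p^(α+1)) such sums are coefficients of a q-binomial product
(`CycloLike.pow_dvd_lacunary_sum`) or, for the correction term, of a Rogers–Szegő polynomial
(`CycloLike.pow_dvd_lacunary_sum'`). What remains of [N]! is prime to p at q = 1 by Legendre's
formula, and Φ_p(1) = p. -/

open Polynomial Finset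

/-! ### Gaussian binomials and Rogers–Szegő polynomials over a commutative ring -/

section Gauss

variable {R S : Type*} [CommRing R] [CommRing S]

/-- The Gaussian binomial coefficient at an element `q` of a commutative ring. -/
def gaussBinom (q : R) : ℕ → ℕ → R
  | _, 0 => 1
  | 0, _ + 1 => 0
  | n + 1, k + 1 => gaussBinom q n k + q ^ (k + 1) * gaussBinom q n (k + 1)

/-- The product `(1 - q) (1 - q ^ 2) ⋯ (1 - q ^ n)`. -/
def qPoch (q : R) (n : ℕ) : R := ∏ i ∈ range n, (1 - q ^ (i + 1))

theorem gaussBinom_zero_right (q : R) (n : ℕ) : gaussBinom q n 0 = 1 := by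
  cases n <;> rfl

theorem gaussBinom_succ_succ (q : R) (n k : ℕ) :
    gaussBinom q (n + 1) (k + 1) = gaussBinom q n k + q ^ (k + 1) * gaussBinom q n (k + 1) := rfl

theorem gaussBinom_of_lt (q : R) {n k : ℕ} (h : n < k) : gaussBinom q n k = 0 := by
  induction n generalizing k with
  | zero => cases k with
    | zero => omega
    | succ k => rfl
  | succ n ih => cases k with
    | zero => omega
    | succ k => rw [gaussBinom_succ_succ, ih (by omega), ih (by omega)]; ring

theorem gaussBinom_self (q : R) (n : ℕ) : gaussBinom q n n = 1 := by
  induction n with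
  | zero => rfl
  | succ n ih => rw [gaussBinom_succ_succ, ih, gaussBinom_of_lt q n.lt_succ_self]; ring

theorem map_gaussBinom (f : R →+* S) (q : R) (n k : ℕ) :
    f (gaussBinom q n k) = gaussBinom (f q) n k := by
  induction n generalizing k with
  | zero => cases k <;> simp [gaussBinom]
  | succ n ih => cases k with
    | zero => simp [gaussBinom]
    | succ k => simp [gaussBinom_succ_succ, ih]

theorem gaussBinom_one (n k : ℕ) : gaussBinom (1 : R) n k = (n.choose k : R) := by
  induction n generalizing k with
  | zero => cases k <;> simp [gaussBinom]
  | succ n ih => cases k with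
    | zero => simp [gaussBinom]
    | succ k => simp [gaussBinom_succ_succ, ih, Nat.choose_succ_succ]

theorem one_sub_pow_mul_gaussBinom (q : R) (n k : ℕ) :
    (1 - q ^ (k + 1)) * gaussBinom q (n + 1) (k + 1) = (1 - q ^ (n + 1)) * gaussBinom q n k := by
  induction n generalizing k with
  | zero => cases k with
    | zero => simp [gaussBinom]
    | succ k => simp [gaussBinom]
  | succ n ih =>
    rw [gaussBinom_succ_succ]
    have h1 := ih k
    cases k with
    | zero =>
      simp only [gaussBinom_zero_right] at *
      linear_combination q ^ (0 + 1) * h1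
    | succ k =>
      have h2 := ih k
      have h3 := gaussBinom_succ_succ q n k
      linear_combination q ^ (k + 1 + 1) * h1 - q * (1 - q ^ (n + 1)) * h3 + q * h2

theorem one_sub_pow_mul_gaussBinom' (q : R) (m k : ℕ) :
    (1 - q ^ (m + 1)) * gaussBinom q (m + 1 + k) k =
      (1 - q ^ (m + 1 + k)) * gaussBinom q (m + k) k := by
  induction k with
  | zero => simp [gaussBinom_zero_right]
  | succ k ih =>
    have h := one_sub_pow_mul_gaussBinom q (m + k) k
    rw [show m + 1 + k = m + k + 1 by ring] at ih
    rw [show m + 1 + (k + 1) = m + k + 1 + 1 by ring, ← add_assoc, gaussBinom_succ_succ q (m + k + 1)]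
    linear_combination ih - h

theorem gaussBinom_mul_qPoch (q : R) (m k : ℕ) :
    gaussBinom q (m + k) k * (qPoch q k * qPoch q m) = qPoch q (m + k) := by
  induction k with
  | zero => simp [gaussBinom_zero_right, qPoch]
  | succ k ih =>
    have h := one_sub_pow_mul_gaussBinom q (m + k) k
    have h1 : ∀ n, qPoch q (n + 1) = qPoch q n * (1 - q ^ (n + 1)) := fun n => prod_range_succ _ _
    rw [← add_assoc, h1, h1, ← ih]
    linear_combination (qPoch q k * qPoch q m) * h

theorem qPoch_succ (q : R) (n : ℕ) : qPoch q (n + 1) = qPoch q n * (1 - q ^ (n + 1)) :=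
  prod_range_succ _ _

/-- The `q`-binomial theorem. -/
theorem prod_one_sub_mul_pow (q y : R) (n : ℕ) :
    ∏ t ∈ range n, (1 - y * q ^ t) =
      ∑ k ∈ range (n + 1), (-1) ^ k * q ^ k.choose 2 * gaussBinom q n k * y ^ k := by
  induction n generalizing y with
  | zero => simp [gaussBinom]
  | succ n ih =>
    have h : ∏ t ∈ range n, (1 - y * q ^ (t + 1)) = ∏ t ∈ range n, (1 - (y * q) * q ^ t) :=
      prod_congr rfl fun t _ => by ring
    rw [prod_range_succ', h, ih, sum_range_succ' _ (n + 1)]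
    have h2 : ∀ k ∈ range (n + 1),
        (-1) ^ (k + 1) * q ^ (k + 1).choose 2 * gaussBinom q (n + 1) (k + 1) * y ^ (k + 1) =
        -y * ((-1) ^ k * q ^ k.choose 2 * gaussBinom q n k * (y * q) ^ k) +
        (-1) ^ (k + 1) * q ^ (k + 1).choose 2 * gaussBinom q n (k + 1) * (y * q) ^ (k + 1) := by
      intro k _
      rw [gaussBinom_succ_succ, Nat.choose_succ_succ' k 1, Nat.choose_one_right]
      ring
    rw [sum_congr rfl h2, sum_add_distrib, ← mul_sum]
    have h3 := sum_range_succ' (fun k => (-1) ^ k * q ^ k.choose 2 * gaussBinom q n k *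
      (y * q) ^ k) (n + 1)
    rw [sum_range_succ, gaussBinom_of_lt q n.lt_succ_self] at h3
    simp only [gaussBinom_zero_right, Nat.choose_zero_succ, pow_zero, mul_one, mul_zero, zero_mul,
      add_zero] at h3 ⊢
    linear_combination h3

/-- The Rogers–Szegő polynomial `∑ₖ [n choose k]_q y ^ k`. -/
def rogersSzego (q y : R) (n : ℕ) : R := ∑ k ∈ range (n + 1), gaussBinom q n k * y ^ k

theorem rogersSzego_eq_sum_range (q y : R) {n N : ℕ} (h : n < N) :
    rogersSzego q y n = ∑ k ∈ range N, gaussBinom q n k * y ^ k := by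
  refine sum_subset (range_mono (by omega)) fun k _ hk => ?_
  rw [gaussBinom_of_lt q (by simpa using hk), zero_mul]

/-- In Pascal's rule write q^(k+1) = 1 - (1 - q^(k+1)); absorption turns the second part into a
multiple of [n, k]. -/
theorem rogersSzego_succ_succ (q y : R) (n : ℕ) :
    rogersSzego q y (n + 2) =
      (1 + y) * rogersSzego q y (n + 1) - (1 - q ^ (n + 1)) * y * rogersSzego q y n := by
  have h : ∀ k, gaussBinom q (n + 2) (k + 1) * y ^ (k + 1) =
      y * (gaussBinom q (n + 1) k * y ^ k) + gaussBinom q (n + 1) (k + 1) * y ^ (k + 1)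
        - (1 - q ^ (n + 1)) * y * (gaussBinom q n k * y ^ k) := fun k => by
    rw [gaussBinom_succ_succ]
    linear_combination -y ^ (k + 1) * one_sub_pow_mul_gaussBinom q n k
  have h0 : rogersSzego q y (n + 1) =
      ∑ k ∈ range (n + 2), gaussBinom q (n + 1) (k + 1) * y ^ (k + 1) + 1 := by
    rw [rogersSzego_eq_sum_range q y (show n + 1 < n + 3 by omega), sum_range_succ' _ (n + 2),
      gaussBinom_zero_right, pow_zero, mul_one]
  rw [rogersSzego, sum_range_succ', sum_congr rfl fun k _ => h k, sum_sub_distrib,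
    sum_add_distrib, ← mul_sum, ← mul_sum, rogersSzego_eq_sum_range q y (show n < n + 2 by omega),
    gaussBinom_zero_right, add_mul, one_mul]
  nth_rw 1 [h0]
  rw [rogersSzego]
  ring

theorem rogersSzego_zero (q y : R) : rogersSzego q y 0 = 1 := by simp [rogersSzego, gaussBinom]

theorem rogersSzego_one (q y : R) : rogersSzego q y 1 = 1 + y := by
  simp [rogersSzego, gaussBinom, sum_range_succ]

/-- The identity `∑ₖ (1 - q ^ k) (1 - q ^ (n - k)) [n choose k]_q y ^ k
= (1 - q ^ n) (1 - q ^ (n - 1)) y H_{n-2}(y)`. -/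
theorem sum_one_sub_mul_one_sub_mul_gaussBinom (q y : R) (n : ℕ) :
    ∑ k ∈ range (n + 3), (1 - q ^ k) * (1 - q ^ (n + 2 - k)) * gaussBinom q (n + 2) k * y ^ k =
      (1 - q ^ (n + 2)) * (1 - q ^ (n + 1)) * y * rogersSzego q y n := by
  rw [sum_range_succ', sum_range_succ, rogersSzego, mul_sum]
  simp only [Nat.sub_self, pow_zero, sub_self, mul_zero, zero_mul, add_zero]
  refine sum_congr rfl fun k hk => ?_
  have hk' : k ≤ n := by simpa [Nat.lt_succ_iff] using hk
  have h1 := one_sub_pow_mul_gaussBinom q (n + 1) k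
  have h2 := one_sub_pow_mul_gaussBinom' q (n - k) k
  rw [show n + 2 - (k + 1) = n - k + 1 by omega]
  rw [show n - k + 1 + k = n + 1 by omega, show n - k + k = n by omega] at h2
  linear_combination (1 - q ^ (n - k + 1)) * y ^ (k + 1) * h1 + (1 - q ^ (n + 2)) * y ^ (k+1) * h2

end Gauss

/-! ### Powers of cyclotomic factors in lacunary q-sums -/

section Divisibility

variable {R : Type*} [CommRing R]

/-- `φ` behaves like the `d`-th cyclotomic polynomial evaluated at `q`. -/
structure CycloLike (q φ : R) (d : ℕ) : Prop where
  dvd_one_sub : φ ∣ 1 - q ^ d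
  dvd_gaussBinom : ∀ k, 0 < k → k < d → φ ∣ gaussBinom q d k

theorem CycloLike.map {S : Type*} [CommRing S] {q φ : R} {d : ℕ} (h : CycloLike q φ d)
    (f : R →+* S) : CycloLike (f q) (f φ) d where
  dvd_one_sub := by simpa using map_dvd f h.dvd_one_sub
  dvd_gaussBinom k h0 hk := by
    simpa [map_gaussBinom] using map_dvd f (h.dvd_gaussBinom k h0 hk)

theorem dvd_one_sub_pow_of_dvd {φ x : R} (h : φ ∣ 1 - x) (n : ℕ) : φ ∣ 1 - x ^ n :=
  h.trans (by simpa using sub_dvd_pow_sub_pow 1 x n)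

/-- Modulo φ the q-binomial theorem leaves only 1 - q^(d choose 2) y^d. For odd d the exponent is a
multiple of d, so this is 1 - y^d. -/
theorem CycloLike.dvd_prod {q φ y : R} {d : ℕ} (h : CycloLike q φ d) (hd : Odd d)
    (hy : φ ∣ 1 - y ^ d) : φ ∣ ∏ t ∈ range d, (1 - y * q ^ t) := by
  obtain ⟨c, rfl⟩ := hd
  rw [prod_one_sub_mul_pow, sum_range_succ, sum_range_succ']
  have h1 : φ ∣ ∑ k ∈ range (2 * c), (-1) ^ (k + 1) * q ^ (k + 1).choose 2 *
      gaussBinom q (2 * c + 1) (k + 1) * y ^ (k + 1) :=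
    Finset.dvd_sum fun k hk => ((h.dvd_gaussBinom (k + 1) (by omega)
      (by have := mem_range.1 hk; omega)).mul_left _).mul_right _
  have h2 : (2 * c + 1).choose 2 = (2 * c + 1) * c := by
    rw [Nat.choose_two_right, Nat.add_sub_cancel, mul_left_comm,
      Nat.mul_div_cancel_left _ (by norm_num)]
  have h3 : φ ∣ 1 - q ^ (2 * c + 1).choose 2 := by
    rw [h2, pow_mul]; exact dvd_one_sub_pow_of_dvd h.dvd_one_sub c
  simp only [gaussBinom_self, gaussBinom_zero_right, pow_zero, Nat.choose_zero_succ, mul_one]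
  have h4 := dvd_add h1 (dvd_add h3 (hy.mul_left (q ^ (2 * c + 1).choose 2)))
  refine h4.trans (dvd_of_eq ?_)
  rw [show (-1 : R) ^ (2 * c + 1) = -1 from Odd.neg_one_pow ⟨c, rfl⟩]
  ring

/-- Each run of d consecutive factors gives one φ, because replacing y by y q^d preserves the
hypothesis on y. -/
theorem CycloLike.pow_dvd_prod {q φ : R} {d : ℕ} (h : CycloLike q φ d) (hd : Odd d) (n : ℕ)
    {y : R} (hy : φ ∣ 1 - y ^ d) : φ ^ (n / d) ∣ ∏ t ∈ range n, (1 - y * q ^ t) := by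
  have key : ∀ a b : ℕ, ∀ y : R, φ ∣ 1 - y ^ d →
      φ ^ a ∣ ∏ t ∈ range (d * a + b), (1 - y * q ^ t) := by
    intro a b
    induction a with
    | zero => intro y _; simp
    | succ a ih =>
      intro y hy
      have hyq : φ ∣ 1 - (y * q ^ d) ^ d := by
        have h1 := dvd_add hy ((dvd_one_sub_pow_of_dvd h.dvd_one_sub d).mul_left (y ^ d))
        refine h1.trans (dvd_of_eq ?_)
        ring
      rw [show d * (a + 1) + b = d + (d * a + b) by ring, prod_range_add, pow_succ']
      refine mul_dvd_mul (h.dvd_prod hd hy) ((ih _ hyq).trans (dvd_of_eq ?_))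
      exact prod_congr rfl fun t _ => by ring
  have := key (n / d) (n % d) y hy
  rwa [Nat.div_add_mod] at this

/-- Modulo φ, H_d is 1 + y^d, and H_{d+1} is a multiple of H_d since q^d is 1. Two consecutive zeros
propagate through the three-term recurrence. -/
theorem CycloLike.dvd_rogersSzego {q φ y : R} {d : ℕ} (h : CycloLike q φ d) (hd : 0 < d)
    (hy : φ ∣ 1 + y ^ d) {n : ℕ} (hn : d ≤ n) : φ ∣ rogersSzego q y n := by
  obtain ⟨c, rfl⟩ : ∃ c, d = c + 1 := ⟨d - 1, by omega⟩
  have h0 : φ ∣ rogersSzego q y (c + 1) := by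
    rw [rogersSzego, sum_range_succ, sum_range_succ', gaussBinom_self, gaussBinom_zero_right,
      pow_zero, mul_one, one_mul, add_assoc]
    exact dvd_add (Finset.dvd_sum fun k hk => (h.dvd_gaussBinom (k + 1) (by omega)
      (by have := mem_range.1 hk; omega)).mul_right _) hy
  have h1 : φ ∣ rogersSzego q y (c + 2) := by
    rw [rogersSzego_succ_succ]
    exact dvd_sub (h0.mul_left _) ((h.dvd_one_sub.mul_right _).mul_right _)
  obtain ⟨t, rfl⟩ := Nat.exists_eq_add_of_le hn
  induction t using Nat.twoStepInduction with
  | zero => exact h0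
  | one => exact h1
  | more t ih1 ih2 =>
    rw [← add_assoc, rogersSzego_succ_succ]
    exact dvd_sub ((ih2 (by omega)).mul_left _) ((ih1 (by omega)).mul_left _)

/-- Quasi-periodicity: for M = d(2e+1), replacing q^M by 1 in the recurrence costs φ times an H
already divisible by φ^e. So H_{M+t} is H_t H_M modulo φ^(e+1), and for t ≥ d the two factors supply
φ and φ^e. -/
theorem CycloLike.pow_dvd_rogersSzego {q φ y : R} {d : ℕ} (h : CycloLike q φ d) (hd : 0 < d)
    (hy : φ ∣ 1 + y ^ d) (e : ℕ) {n : ℕ} (hn : 2 * d * e ≤ n) :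
    φ ^ e ∣ rogersSzego q y n := by
  induction e generalizing n with
  | zero => simp
  | succ e ih =>
    -- A multiple of d exceeding 2de, so that H_c is also covered by induction, and leaving d
    -- indices up to 2d(e+1).
    obtain ⟨c, hc⟩ : ∃ c, d * (2 * e + 1) = c + 1 :=
      ⟨d * (2 * e + 1) - 1, by have : 0 < d * (2 * e + 1) := by positivity
                               omega⟩
    have hq : φ ∣ 1 - q ^ (c + 1) := by
      rw [← hc, pow_mul]; exact dvd_one_sub_pow_of_dvd h.dvd_one_sub _
    have hce : 2 * d * e ≤ c := by
      have : d * (2 * e + 1) = 2 * d * e + d := by ring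
      omega
    have key : ∀ t, φ ^ (e + 1) ∣ rogersSzego q y (c + 1 + t) -
        rogersSzego q y t * rogersSzego q y (c + 1) := by
      intro t
      induction t using Nat.twoStepInduction with
      | zero => simp [rogersSzego_zero]
      | one =>
        rw [rogersSzego_succ_succ, rogersSzego_one, pow_succ']
        have := (mul_dvd_mul hq (ih hce)).mul_left (-y)
        refine this.trans (dvd_of_eq ?_)
        ring
      | more t h1 h2 =>
        have h3 := (mul_dvd_mul hq (ih (show 2 * d * e ≤ c + 1 + t by omega))).mul_left
          (-y * q ^ (t + 1))
        rw [← pow_succ'] at h3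
        have h4 := dvd_add h3 (dvd_sub (h2.mul_left (1 + y))
          (h1.mul_left ((1 - q ^ (t + 1)) * y)))
        refine h4.trans (dvd_of_eq ?_)
        rw [rogersSzego_succ_succ q y t, ← add_assoc (c + 1), ← add_assoc (c + 1),
          rogersSzego_succ_succ]
        ring
    obtain ⟨t, rfl⟩ := Nat.exists_eq_add_of_le (show c + 1 ≤ n by
      rw [← hc]
      have : 2 * d * (e + 1) = d * (2 * e + 1) + d := by ring
      omega)
    have ht : d ≤ t := by
      have : 2 * d * (e + 1) = d * (2 * e + 1) + d := by ring
      omega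
    have h5 := mul_dvd_mul (h.dvd_rogersSzego hd hy ht) (ih (show 2 * d * e ≤ c + 1 by omega))
    rw [← pow_succ'] at h5
    simpa using dvd_add (key t) h5

theorem algebraMap_dvd_iff_coeff {m : ℕ} {u : R} {f : AddMonoidAlgebra R (ZMod m)}
    (h : algebraMap R (AddMonoidAlgebra R (ZMod m)) u ∣ f) (r : ZMod m) : u ∣ f.coeff r := by
  obtain ⟨g, rfl⟩ := h
  rw [← Algebra.smul_def, AddMonoidAlgebra.coeff_smul_apply, smul_eq_mul]
  exact dvd_mul_right _ _

/-- The generator of the group algebra records k modulo m, and reading off one coefficient selects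
the residue class. Unlike a root-of-unity filter, this needs no division by m. -/
theorem dvd_lacunary_sum {n m : ℕ} {r : ℤ} {u : R} {c : ℕ → R}
    (h : algebraMap R (AddMonoidAlgebra R (ZMod m)) u ∣
      ∑ k ∈ range (n + 1), algebraMap R (AddMonoidAlgebra R (ZMod m)) (c k) *
        (AddMonoidAlgebra.single 1 1) ^ k) :
    u ∣ ∑ k ∈ lacunary n m r, c k := by
  convert algebraMap_dvd_iff_coeff h (r : ZMod m) using 1
  rw [AddMonoidAlgebra.coeff_sum, Finsupp.finsetSum_apply, lacunary, sum_filter]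
  refine sum_congr rfl fun k _ => ?_
  rw [← Algebra.smul_def, AddMonoidAlgebra.coeff_smul_apply, AddMonoidAlgebra.single_pow,
    AddMonoidAlgebra.coeff_single, Finsupp.single_apply]
  simp [← ZMod.intCast_eq_intCast_iff]

theorem single_pow_eq_one {m d : ℕ} (h : m ∣ d) :
    (AddMonoidAlgebra.single 1 1 : AddMonoidAlgebra R (ZMod m)) ^ d = 1 := by
  rw [AddMonoidAlgebra.single_pow, AddMonoidAlgebra.one_def]
  congr 1
  · rw [nsmul_one]; exact (ZMod.natCast_eq_zero_iff _ _).2 h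
  · simp

theorem CycloLike.pow_dvd_lacunary_sum {q φ : R} {d m : ℕ} (h : CycloLike q φ d) (hd : Odd d)
    (hm : m ∣ d) (n i : ℕ) (r : ℤ) :
    φ ^ (n / d) ∣ ∑ k ∈ lacunary n m r,
      (-1) ^ k * q ^ k.choose 2 * gaussBinom q n k * q ^ (i * k) := by
  apply dvd_lacunary_sum
  set T := AddMonoidAlgebra R (ZMod m)
  set f := algebraMap R T
  have hT := h.map f
  have hy : f φ ∣ 1 - (f q ^ i * AddMonoidAlgebra.single 1 1 : T) ^ d := by
    rw [mul_pow, single_pow_eq_one hm, mul_one, ← pow_mul, mul_comm i, pow_mul]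
    exact dvd_one_sub_pow_of_dvd hT.dvd_one_sub i
  have h1 := hT.pow_dvd_prod hd n hy
  rw [prod_one_sub_mul_pow] at h1
  rw [map_pow]
  refine h1.trans (dvd_of_eq (sum_congr rfl fun k _ => ?_))
  simp only [map_mul, map_pow, map_neg, map_one, map_gaussBinom]
  ring

/-- The factors (1 - q^k)(1 - q^(n-k)) lower the sum to H_{n-2} at y = -q^i g, with g the group
generator; for odd d, 1 + y^d = 1 - q^(id). Asking 4de ≤ n instead of 2de ≤ n pays for the lost two
indices. -/
theorem CycloLike.pow_dvd_lacunary_sum' {q φ : R} {d m : ℕ} (h : CycloLike q φ d) (hd : Odd d)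
    (hm : m ∣ d) (n i e : ℕ) (he : 4 * d * e ≤ n) (r : ℤ) :
    φ ^ e ∣ ∑ k ∈ lacunary n m r,
      (-1) ^ k * (1 - q ^ k) * (1 - q ^ (n - k)) * gaussBinom q n k * q ^ (i * k) := by
  rcases Nat.eq_zero_or_pos e with rfl | he0
  · simp
  have hd0 : 0 < d := hd.pos
  have hde : 1 ≤ d * e := Nat.mul_pos hd0 he0
  have hn : 2 * d * e ≤ n - 2 := by
    have h1 : 4 * d * e = 4 * (d * e) := by ring
    have h2 : 2 * d * e = 2 * (d * e) := by ring
    omega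
  obtain ⟨n, rfl⟩ : ∃ m, n = m + 2 := ⟨n - 2, by rw [mul_assoc] at he; omega⟩
  apply dvd_lacunary_sum
  set T := AddMonoidAlgebra R (ZMod m)
  set f := algebraMap R T
  have hT := h.map f
  have hy : f φ ∣ 1 + (-(f q ^ i * AddMonoidAlgebra.single 1 1) : T) ^ d := by
    rw [hd.neg_pow, mul_pow, single_pow_eq_one hm, mul_one, ← pow_mul, mul_comm i, pow_mul,
      ← sub_eq_add_neg]
    exact dvd_one_sub_pow_of_dvd hT.dvd_one_sub i
  have h1 := (hT.pow_dvd_rogersSzego hd0 hy e hn).mul_left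
    ((1 - f q ^ (n + 2)) * (1 - f q ^ (n + 1)) * -(f q ^ i * AddMonoidAlgebra.single 1 1))
  rw [Nat.add_sub_cancel, ← sum_one_sub_mul_one_sub_mul_gaussBinom] at h1
  rw [map_pow]
  refine h1.trans (dvd_of_eq (sum_congr rfl fun k _ => ?_))
  simp only [map_mul, map_pow, map_neg, map_one, map_gaussBinom, map_sub]
  rw [neg_pow]
  ring

theorem cyclotomic_dvd_iff {d : ℕ} (hd : 0 < d) {z : ℂ} (hz : IsPrimitiveRoot z d) (f : ℤ[X]) :
    cyclotomic d ℤ ∣ f ↔ aeval z f = 0 := by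
  rw [cyclotomic_eq_minpoly hz hd, minpoly.isIntegrallyClosed_dvd_iff (hz.isIntegral hd)]

theorem cyclotomic_dvd_one_sub_X_pow_iff {d : ℕ} (hd : 0 < d) (a : ℕ) :
    cyclotomic d ℤ ∣ 1 - X ^ a ↔ d ∣ a := by
  have hz := Complex.isPrimitiveRoot_exp d hd.ne'
  rw [cyclotomic_dvd_iff hd hz, ← hz.pow_eq_one_iff_dvd]
  rw [map_sub, map_one, map_pow, aeval_X, sub_eq_zero, eq_comm]

theorem prime_cyclotomic {d : ℕ} (hd : 0 < d) : Prime (cyclotomic d ℤ) :=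
  (cyclotomic.irreducible hd).prime

/-- In (1 - q^k)[d, k] = (1 - q^d)[d-1, k-1] the prime Φ_d divides the right side but not 1 - q^k
for 0 < k < d. -/
theorem cycloLike_cyclotomic {d : ℕ} (hd : 0 < d) :
    CycloLike (X : ℤ[X]) (cyclotomic d ℤ) d where
  dvd_one_sub := (cyclotomic_dvd_one_sub_X_pow_iff hd d).2 dvd_rfl
  dvd_gaussBinom k h0 hk := by
    have h1 := (cyclotomic_dvd_one_sub_X_pow_iff hd d).2 dvd_rfl
    obtain ⟨d, rfl⟩ : ∃ c, d = c + 1 := ⟨d - 1, by omega⟩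
    obtain ⟨k, rfl⟩ : ∃ c, k = c + 1 := ⟨k - 1, by omega⟩
    have h := one_sub_pow_mul_gaussBinom (X : ℤ[X]) d k
    refine ((prime_cyclotomic hd).dvd_or_dvd (h ▸ h1.mul_right _)).resolve_left fun h2 => ?_
    exact Nat.not_dvd_of_pos_of_lt h0 hk ((cyclotomic_dvd_one_sub_X_pow_iff hd _).1 h2)

end Divisibility

/-! ### A quadratic sum over roots of unity -/

section RootsOfUnity

variable {K : Type*} [Field K]

/-- This writes 1/(1 - z) as a polynomial in z, which opens the inverse squares below to
orthogonality. -/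
theorem one_sub_mul_sum_mul_pow {z : K} {n : ℕ} (hz : z ^ n = 1) (hz1 : z ≠ 1) :
    (1 - z) * ∑ k ∈ range n, (k : K) * z ^ k = -n := by
  have h : ∀ m : ℕ, (1 - z) ^ 2 * ∑ k ∈ range m, (k : K) * z ^ k =
      (1 - z ^ m) * z - m * z ^ m * (1 - z) := by
    intro m
    induction m with
    | zero => simp
    | succ m ih => rw [sum_range_succ, mul_add, ih]; push_cast; ring
  have h1 : (1 - z) ≠ 0 := sub_ne_zero.2 hz1.symm
  apply mul_left_cancel₀ h1
  have := h n
  rw [hz] at this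
  linear_combination this

/-- Orthogonality of characters; the power n - 1 stands for the inverse. -/
theorem IsPrimitiveRoot.sum_pow_mul_pow {z : K} {n : ℕ} (hz : IsPrimitiveRoot z n) {j k : ℕ}
    (hj : j < n) (hk : k < n) :
    ∑ t ∈ range n, (z ^ t) ^ j * ((z ^ t) ^ (n - 1)) ^ k = if j = k then (n : K) else 0 := by
  have h : ∀ t, (z ^ t) ^ j * ((z ^ t) ^ (n - 1)) ^ k = (z ^ (j + (n - 1) * k)) ^ t := by
    intro t; simp only [← pow_mul, ← pow_add]; congr 1; ring
  simp only [h]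
  have hdvd : n ∣ j + (n - 1) * k ↔ j = k := by
    obtain ⟨n, rfl⟩ : ∃ m, n = m + 1 := ⟨n - 1, by omega⟩
    rw [Nat.add_sub_cancel, ← Int.natCast_dvd_natCast]
    have h1 : ((j + n * k : ℕ) : ℤ) = (j - k) + (n + 1 : ℕ) * k := by push_cast; ring
    rw [h1, dvd_add_left (dvd_mul_right _ _)]
    constructor
    · intro h2
      have := Int.eq_zero_of_abs_lt_dvd h2 (by rw [abs_lt]; omega)
      omega
    · rintro rfl; simp
  split_ifs with hjk
  · rw [(hz.pow_eq_one_iff_dvd _).2 (hdvd.2 hjk)]; simp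
  · have h1 : z ^ (j + (n - 1) * k) ≠ 1 := fun h => hjk (hdvd.1 ((hz.pow_eq_one_iff_dvd _).1 h))
    have h2 := mul_neg_geom_sum (z ^ (j + (n - 1) * k)) n
    rw [← pow_mul, mul_comm _ n, pow_mul, hz.pow_eq_one, one_pow, sub_self] at h2
    exact (mul_eq_zero.1 h2).resolve_left (sub_ne_zero.2 h1.symm)

theorem six_mul_sum_range_sq (n : ℕ) :
    6 * ∑ k ∈ range n, (k : K) ^ 2 = n * (n - 1) * (2 * n - 1) := by
  induction n with
  | zero => simp
  | succ n ih => rw [sum_range_succ, mul_add, ih]; push_cast; ring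

theorem two_mul_sum_range (n : ℕ) : 2 * ∑ k ∈ range n, (k : K) = n * (n - 1) := by
  induction n with
  | zero => simp
  | succ n ih => rw [sum_range_succ, mul_add, ih]; push_cast; ring

/-- `∑_{0 < t < n} 1 / |1 - ζ ^ t| ^ 2 = (n ^ 2 - 1) / 12` for a primitive `n`-th root of unity. -/
theorem IsPrimitiveRoot.sum_inv_one_sub_mul [CharZero K] {z : K} {n : ℕ}
    (hz : IsPrimitiveRoot z (n + 1)) :
    12 * ∑ t ∈ range n, ((1 - z ^ (t + 1)) * (1 - z ^ (n - t)))⁻¹ = ((n : K) + 1) ^ 2 - 1 := by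
  have hn0 : ((n : K) + 1) ≠ 0 := by exact_mod_cast Nat.succ_ne_zero n
  have hterm : ∀ t ∈ range n, ((1 - z ^ (t + 1)) * (1 - z ^ (n - t)))⁻¹ * ((n : K) + 1) ^ 2 =
      (∑ j ∈ range (n + 1), (j : K) * (z ^ (t + 1)) ^ j) *
        ∑ k ∈ range (n + 1), (k : K) * ((z ^ (t + 1)) ^ n) ^ k := by
    intro t ht
    have ht' := mem_range.1 ht
    have hpow : z ^ (n - t) = (z ^ (t + 1)) ^ n := by
      rw [← pow_mul, show (t + 1) * n = (n - t) + (n + 1) * t by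
        obtain ⟨s, rfl⟩ := Nat.exists_eq_add_of_lt ht'
        rw [show t + s + 1 - t = s + 1 by omega]; ring, pow_add, pow_mul, hz.pow_eq_one]
      simp
    have h1 : z ^ (t + 1) ≠ 1 := hz.pow_ne_one_of_pos_of_lt (by omega) (by omega)
    have h2 : z ^ (n - t) ≠ 1 := hz.pow_ne_one_of_pos_of_lt (by omega) (by omega)
    have e1 : ∀ a, (z ^ a) ^ (n + 1) = 1 := fun a => by
      rw [← pow_mul, mul_comm, pow_mul, hz.pow_eq_one, one_pow]
    have h3 := one_sub_mul_sum_mul_pow (e1 (t + 1)) h1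
    have h4 := one_sub_mul_sum_mul_pow (e1 (n - t)) h2
    rw [← hpow]
    have h5 : (1 - z ^ (t + 1)) ≠ 0 := sub_ne_zero.2 h1.symm
    have h6 : (1 - z ^ (n - t)) ≠ 0 := sub_ne_zero.2 h2.symm
    rw [inv_mul_eq_iff_eq_mul₀ (mul_ne_zero h5 h6)]
    push_cast at h3 h4
    linear_combination (-(1 - z ^ (n - t)) *
      ∑ k ∈ range (n + 1), (k : K) * (z ^ (n - t)) ^ k) * h3 + ((n : K) + 1) * h4
  -- Parseval over all t. The term t = 0, equal to (∑ j)^2, is split off afterwards.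
  have hfull : ∑ t ∈ range (n + 1), (∑ j ∈ range (n + 1), (j : K) * (z ^ t) ^ j) *
        (∑ k ∈ range (n + 1), (k : K) * ((z ^ t) ^ n) ^ k) =
      ((n : K) + 1) * ∑ k ∈ range (n + 1), (k : K) ^ 2 := by
    simp only [sum_mul_sum]
    rw [sum_comm, mul_sum]
    refine sum_congr rfl fun j hj => ?_
    rw [sum_comm]
    have h1 : ∀ k ∈ range (n + 1), ∑ t ∈ range (n + 1),
        (j : K) * (z ^ t) ^ j * ((k : K) * ((z ^ t) ^ n) ^ k) =
        if j = k then (j : K) * k * (n + 1) else 0 := by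
      intro k hk
      have h2 := hz.sum_pow_mul_pow (mem_range.1 hj) (mem_range.1 hk)
      rw [Nat.add_sub_cancel] at h2
      calc _ = (j : K) * k * ∑ t ∈ range (n + 1), (z ^ t) ^ j * ((z ^ t) ^ n) ^ k := by
            rw [mul_sum]; exact sum_congr rfl fun t _ => by ring
        _ = _ := by rw [h2]; split_ifs <;> push_cast <;> ring
    rw [sum_congr rfl h1, sum_ite_eq, if_pos hj]
    ring
  rw [sum_range_succ', ← sum_congr rfl hterm, ← sum_mul] at hfull
  simp only [pow_zero, one_pow, mul_one] at hfull
  have h1 := six_mul_sum_range_sq (K := K) (n + 1)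
  have h2 := two_mul_sum_range (K := K) (n + 1)
  apply mul_right_cancel₀ (pow_ne_zero 2 hn0)
  push_cast at h1 h2
  linear_combination 12 * hfull + 2 * ((n : K) + 1) * h1 -
    (6 * (∑ k ∈ range (n + 1), (k : K)) + 3 * ((n : K) + 1) * n) * h2

end RootsOfUnity

/-! ### The termwise congruence modulo the cube of Φ_p -/

section Coefficientwise

variable {R : Type*} [CommRing R]

/-- First-order Taylor expansion in w; since w y = w, powers of y disappear from the linear term. -/
theorem prod_mul_add_of_sq_zero {ι : Type*} [DecidableEq ι] (s : Finset ι) (a : ι → R) {w y : R}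
    (hw : w * w = 0) (hy : w * y = w) :
    ∏ t ∈ s, (y * a t + w) = y ^ #s * ∏ t ∈ s, a t + w * ∑ t ∈ s, ∏ u ∈ s.erase t, a u := by
  have hyn : ∀ n : ℕ, w * y ^ n = w := fun n => by
    induction n with
    | zero => simp
    | succ n ih => rw [pow_succ, ← mul_assoc, ih, hy]
  induction s using Finset.induction with
  | empty => simp
  | insert i s hi ih =>
    rw [prod_insert hi, prod_insert hi, sum_insert hi, erase_insert hi, card_insert_of_notMem hi,
      ih]
    have h : ∀ t ∈ s, ∏ u ∈ (insert i s).erase t, a u = a i * ∏ u ∈ s.erase t, a u := by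
      intro t ht
      rw [erase_insert_of_ne (by rintro rfl; exact hi ht), prod_insert (by simp [hi])]
    rw [sum_congr rfl h, ← mul_sum]
    linear_combination (a i * ∑ t ∈ s, ∏ u ∈ s.erase t, a u) * hy +
      (∏ t ∈ s, a t) * hyn (Finset.card s) + (∑ t ∈ s, ∏ u ∈ s.erase t, a u) * hw

theorem prod_range_two_mul (h : ℕ) (f : ℕ → R) :
    ∏ t ∈ range (2 * h), f t = ∏ t ∈ range h, (f t * f (2 * h - 1 - t)) := by
  rw [two_mul, prod_range_add, prod_mul_distrib, ← prod_range_reflect (fun t => f (h + t))]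
  congr 1
  refine prod_congr rfl fun t ht => ?_
  have := mem_range.1 ht
  congr 1; omega

/-- The product `∏_{0 < t ≤ 2h} (1 - y q ^ t)`. -/
def qBlock (q : R) (h : ℕ) (y : R) : R := ∏ t ∈ range (2 * h), (1 - y * q ^ (t + 1))

/-- The value `(1 - q ^ t) (1 - q ^ (p - t))`, shifted by one, for `p = 2h + 1`. -/
def qPair (q : R) (h t : ℕ) : R := (1 - q ^ (t + 1)) * (1 - q ^ (2 * h - t))

/-- The derivative of the product of the `qPair`s. -/
def qPairDeriv (q : R) (h : ℕ) : R := ∑ t ∈ range h, ∏ u ∈ (range h).erase t, qPair q h u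

theorem qBlock_eq_prod (q : R) (h : ℕ) (y : R) :
    qBlock q h y = ∏ t ∈ range h, (y * qPair q h t + (1 - y) * (1 - y * q ^ (2 * h + 1))) := by
  rw [qBlock, prod_range_two_mul]
  refine prod_congr rfl fun t ht => ?_
  have ht' := mem_range.1 ht
  rw [show 2 * h - 1 - t + 1 = 2 * h - t by omega, qPair,
    show 2 * h + 1 = (t + 1) + (2 * h - t) by omega, pow_add]
  ring

theorem qBlock_one (q : R) (h : ℕ) : qBlock q h 1 = ∏ t ∈ range h, qPair q h t := by
  simp [qBlock_eq_prod]

section Nilpotent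

variable {q : R} {p : ℕ}

theorem sq_mul_pow_of_cube_zero (hδ : (1 - q ^ p) ^ 3 = 0) (j : ℕ) :
    (1 - q ^ p) ^ 2 * q ^ (p * j) = (1 - q ^ p) ^ 2 := by
  induction j with
  | zero => simp
  | succ j ih =>
    rw [mul_add, mul_one, pow_add, ← mul_assoc, ih]
    linear_combination -hδ

theorem mul_one_sub_pow_of_cube_zero (hδ : (1 - q ^ p) ^ 3 = 0) (j : ℕ) :
    (1 - q ^ p) * (1 - q ^ (p * j)) = j * (1 - q ^ p) ^ 2 := by
  induction j with
  | zero => simp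
  | succ j ih =>
    rw [mul_add, mul_one, pow_add]
    push_cast
    linear_combination ih + sq_mul_pow_of_cube_zero hδ j

theorem one_sub_mul_one_sub_of_cube_zero (hδ : (1 - q ^ p) ^ 3 = 0) (i j : ℕ) :
    (1 - q ^ (p * i)) * (1 - q ^ (p * j)) = i * j * (1 - q ^ p) ^ 2 := by
  have h1 := mul_neg_geom_sum (q ^ p) i
  rw [← pow_mul] at h1
  have h2 : (1 - q ^ p) ^ 2 * ∑ k ∈ range i, (q ^ p) ^ k = i * (1 - q ^ p) ^ 2 := by
    rw [mul_sum, sum_congr rfl fun k _ => by rw [← pow_mul, sq_mul_pow_of_cube_zero hδ k]]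
    simp
  linear_combination -(1 - q ^ (p * j)) * h1 +
    (∑ k ∈ range i, (q ^ p) ^ k) * mul_one_sub_pow_of_cube_zero hδ j + j * h2

/-- `∑_{j < n} j (j + 1) = (n ^ 3 - n) / 3`. -/
def sumPronic (n : ℕ) : ℕ := ∑ j ∈ range n, j * (j + 1)

theorem three_mul_sumPronic (n : ℕ) : 3 * (sumPronic n : ℤ) = n ^ 3 - n := by
  induction n with
  | zero => simp [sumPronic]
  | succ n ih =>
    rw [sumPronic, sum_range_succ, ← sumPronic]
    push_cast
    linear_combination ih

/-- With n = m + k, the defect n k (n - k) from additivity is the origin of the correction sum. -/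
theorem sumPronic_add (m k : ℕ) :
    sumPronic (m + k) = sumPronic k + sumPronic m + (m + k) * k * m := by
  have h1 := three_mul_sumPronic m
  have h2 := three_mul_sumPronic k
  have h3 := three_mul_sumPronic (m + k)
  push_cast at h3
  zify
  linarith

theorem choose_two_add (m k : ℕ) :
    (m + k).choose 2 = m.choose 2 + k.choose 2 + m * k := by
  induction k with
  | zero => simp
  | succ k ih =>
    rw [← add_assoc, Nat.choose_succ_succ', Nat.choose_succ_succ' k, ih]
    simp only [Nat.choose_one_right]; ring

theorem choose_two_mul (p k : ℕ) :
    (k * p).choose 2 = k ^ 2 * p.choose 2 + p * k.choose 2 := by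
  induction k with
  | zero => simp
  | succ k ih =>
    rw [add_mul, one_mul, choose_two_add, ih, Nat.choose_succ_succ' k, Nat.choose_one_right]
    have h : p * p = 2 * p.choose 2 + p := by
      cases p with
      | zero => simp
      | succ p =>
        have h1 := Nat.add_one_mul_choose_eq p 1
        simp only [Nat.choose_one_right] at h1
        linarith
    linear_combination k * h

variable {h : ℕ} {κ : R}

/-- With y = q^(pj) the perturbation (1 - y)(1 - y q^p) is j(j+1)(1 - q^p)^2. The value of the
derivative is needed only after multiplication by this square, hence the form of `hE`. -/
theorem qBlock_of_cube_zero (hδ : (1 - q ^ (2 * h + 1)) ^ 3 = 0)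
    (hE : (1 - q ^ (2 * h + 1)) ^ 2 * qPairDeriv q h =
      (1 - q ^ (2 * h + 1)) ^ 2 * (κ * qBlock q h 1)) (j : ℕ) :
    qBlock q h (q ^ ((2 * h + 1) * j)) = qBlock q h 1 *
      (q ^ ((2 * h + 1) * (h * j)) + κ * (j * (j + 1) : ℕ) * (1 - q ^ (2 * h + 1)) ^ 2) := by
  set p := 2 * h + 1
  have hw : (1 - q ^ (p * j)) * (1 - q ^ (p * j) * q ^ p) =
      (j * (j + 1) : ℕ) * (1 - q ^ p) ^ 2 := by
    rw [← pow_add, ← Nat.mul_succ, one_sub_mul_one_sub_of_cube_zero hδ]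
    push_cast; ring
  rw [qBlock_eq_prod, hw, prod_mul_add_of_sq_zero, ← qBlock_one, card_range, ← qPairDeriv]
  · rw [← pow_mul, show p * j * h = p * (h * j) by ring]
    linear_combination ((j * (j + 1) : ℕ) : R) * hE
  · linear_combination ((j * (j + 1) : ℕ) : R) ^ 2 * (1 - q ^ p) * hδ
  · rw [mul_assoc, sq_mul_pow_of_cube_zero hδ]

/-- The product of the factors of `(q; q)_{pn}` whose index is prime to `p = 2h + 1`. -/
def qBlockProd (q : R) (h n : ℕ) : R := ∏ j ∈ range n, qBlock q h (q ^ ((2 * h + 1) * j))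

theorem map_qBlockProd {S : Type*} [CommRing S] (f : R →+* S) (q : R) (h n : ℕ) :
    f (qBlockProd q h n) = qBlockProd (f q) h n := by
  simp [qBlockProd, qBlock]

theorem qBlockProd_of_cube_zero (hδ : (1 - q ^ (2 * h + 1)) ^ 3 = 0)
    (hE : (1 - q ^ (2 * h + 1)) ^ 2 * qPairDeriv q h =
      (1 - q ^ (2 * h + 1)) ^ 2 * (κ * qBlock q h 1)) (n : ℕ) :
    qBlockProd q h n = qBlock q h 1 ^ n * (q ^ ((2 * h + 1) * (h * n.choose 2)) +
      κ * sumPronic n * (1 - q ^ (2 * h + 1)) ^ 2) := by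
  induction n with
  | zero => simp [qBlockProd, sumPronic]
  | succ n ih =>
    rw [qBlockProd, prod_range_succ, ← qBlockProd, ih, qBlock_of_cube_zero hδ hE,
      show sumPronic (n + 1) = sumPronic n + n * (n + 1) from sum_range_succ _ _, Nat.choose_succ_succ' n, Nat.choose_one_right]
    have h1 := sq_mul_pow_of_cube_zero hδ (h * n)
    have h2 := sq_mul_pow_of_cube_zero hδ (h * n.choose 2)
    have h3 : q ^ ((2 * h + 1) * (h * (n + n.choose 2))) =
      q ^ ((2 * h + 1) * (h * n.choose 2)) * q ^ ((2 * h + 1) * (h * n)) := by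
      rw [← pow_add]; congr 1; ring
    rw [h3]
    push_cast
    linear_combination qBlock q h 1 ^ (n + 1) * (κ * sumPronic n * h1 +
      κ * (n * (n + 1)) * h2 +
      κ * sumPronic n * (κ * (n * (n + 1))) * (1 - q ^ (2 * h + 1)) * hδ)

theorem qPoch_mul (q : R) (h n : ℕ) :
    qPoch q ((2 * h + 1) * n) = qBlockProd q h n * qPoch (q ^ (2 * h + 1)) n := by
  induction n with
  | zero => simp [qPoch, qBlockProd]
  | succ n ih =>
    rw [qBlockProd, prod_range_succ, ← qBlockProd, qPoch_succ, Nat.mul_succ, ← add_assoc,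
      qPoch_succ, qPoch, prod_range_add, ← qPoch, ih, qBlock]
    have : ∏ x ∈ range (2 * h), (1 - q ^ ((2 * h + 1) * n + x + 1)) =
        ∏ x ∈ range (2 * h), (1 - q ^ ((2 * h + 1) * n) * q ^ (x + 1)) :=
      prod_congr rfl fun x _ => by ring
    rw [this]
    ring

end Nilpotent

theorem qPoch_X_pow_ne_zero {a : ℕ} (ha : 0 < a) (n : ℕ) : qPoch ((X : ℤ[X]) ^ a) n ≠ 0 := by
  refine prod_ne_zero_iff.2 fun i _ h => ?_
  rw [← pow_mul, sub_eq_zero] at h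
  have := congrArg natDegree h
  rw [natDegree_one, natDegree_X_pow] at this
  exact absurd this.symm (by positivity)

theorem gaussBinom_mul_qBlockProd (h m k : ℕ) :
    gaussBinom (X : ℤ[X]) ((2 * h + 1) * (m + k)) ((2 * h + 1) * k) *
      (qBlockProd X h k * qBlockProd X h m) =
    qBlockProd X h (m + k) * gaussBinom ((X : ℤ[X]) ^ (2 * h + 1)) (m + k) k := by
  have h0 := qPoch_X_pow_ne_zero (show 0 < 2 * h + 1 by omega)
  apply mul_right_cancel₀ (mul_ne_zero (h0 k) (h0 m))
  have h1 := gaussBinom_mul_qPoch (X : ℤ[X]) ((2 * h + 1) * m) ((2 * h + 1) * k)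
  have h2 := gaussBinom_mul_qPoch ((X : ℤ[X]) ^ (2 * h + 1)) m k
  rw [← mul_add, qPoch_mul, qPoch_mul, qPoch_mul] at h1
  linear_combination h1 - qBlockProd X h (m + k) * h2

/-- At a primitive root the logarithmic derivative is the sum of 1/((1 - ζ^t)(1 - ζ^(p-t))) over
half of the range, that is, half of (p^2 - 1)/12. -/
theorem cyclotomic_dvd_qPairDeriv_sub {h : ℕ} {κ : ℤ} (hh : 0 < h)
    (hκ : 24 * κ = (2 * h + 1) ^ 2 - 1) :
    cyclotomic (2 * h + 1) ℤ ∣ qPairDeriv X h - (κ : ℤ[X]) * qBlock X h 1 := by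
  have hz := Complex.isPrimitiveRoot_exp (2 * h + 1) (by omega)
  rw [cyclotomic_dvd_iff (by omega) hz]
  set z := Complex.exp (2 * Real.pi * Complex.I / (2 * h + 1 : ℕ))
  rw [qBlock_one]
  simp only [qPairDeriv, qPair, map_sub, map_mul, map_sum, map_prod, map_one, map_pow, aeval_X,
    map_intCast]
  set a : ℕ → ℂ := fun t => (1 - z ^ (t + 1)) * (1 - z ^ (2 * h - t)) with ha
  have ha0 : ∀ t ∈ range h, a t ≠ 0 := by
    intro t ht
    have := mem_range.1 ht
    exact mul_ne_zero
      (sub_ne_zero.2 (hz.pow_ne_one_of_pos_of_lt (by omega) (by omega)).symm)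
      (sub_ne_zero.2 (hz.pow_ne_one_of_pos_of_lt (by omega) (by omega)).symm)
  have h1 : ∀ t ∈ range h, ∏ u ∈ (range h).erase t, a u = (∏ u ∈ range h, a u) * (a t)⁻¹ := by
    intro t ht
    rw [← mul_prod_erase _ _ ht]
    field_simp [ha0 t ht]
  have h2 := hz.sum_inv_one_sub_mul
  have h3 : ∑ t ∈ range (2 * h), (a t)⁻¹ = 2 * ∑ t ∈ range h, (a t)⁻¹ := by
    rw [two_mul h, sum_range_add, ← sum_range_reflect (fun t => (a (h + t))⁻¹), two_mul]
    congr 1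
    refine sum_congr rfl fun t ht => ?_
    have := mem_range.1 ht
    simp only [ha]
    rw [show h + (h - 1 - t) + 1 = 2 * h - t by omega,
      show 2 * h - (h + (h - 1 - t)) = t + 1 by omega, mul_comm]
  rw [h3] at h2
  rw [sum_congr rfl h1, ← mul_sum]
  have h4 : (24 : ℂ) * κ = (2 * h + 1) ^ 2 - 1 := by exact_mod_cast hκ
  push_cast at h2
  linear_combination (∏ u ∈ range h, a u) / 24 * (h2 - h4)

theorem cyclotomic_not_dvd_qBlockProd (h n : ℕ) :
    ¬ cyclotomic (2 * h + 1) ℤ ∣ qBlockProd X h n := by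
  have hp := prime_cyclotomic (show 0 < 2 * h + 1 by omega)
  rw [qBlockProd, hp.dvd_finsetProd_iff]
  rintro ⟨j, -, hj⟩
  rw [qBlock, hp.dvd_finsetProd_iff] at hj
  obtain ⟨t, ht, hj⟩ := hj
  rw [← pow_add, cyclotomic_dvd_one_sub_X_pow_iff (by omega),
    Nat.dvd_add_right (dvd_mul_right _ _)] at hj
  exact Nat.not_dvd_of_pos_of_lt (by omega) (by have := mem_range.1 ht; omega) hj

/-- The congruence modulo `Φ_p(q) ^ 3` between the summands of the two sums, `p` odd with
`24 κ = p ^ 2 - 1`. -/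
theorem cyclotomic_pow_three_dvd {h : ℕ} {κ : ℤ} (hh : 0 < h)
    (hκ : 24 * κ = (2 * h + 1) ^ 2 - 1) {p n k : ℕ} (hp : p = 2 * h + 1) (hk : k ≤ n) :
    cyclotomic p ℤ ^ 3 ∣ X ^ (k * p).choose 2 * gaussBinom X (p * n) (p * k) -
      (X ^ (n * k * p.choose 2 + p * k.choose 2) * gaussBinom (X ^ p) n k +
      (κ : ℤ[X]) * (n : ℤ[X]) * ((1 - X ^ (k * p)) * (1 - X ^ ((n - k) * p)) *
        gaussBinom (X ^ p) n k)) := by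
  subst hp
  obtain ⟨m, rfl⟩ := Nat.exists_eq_add_of_le' hk
  rw [Nat.add_sub_cancel]
  have hprime := prime_cyclotomic (show 0 < 2 * h + 1 by omega)
  -- Multiplying by block products prime to Φ clears the denominator of the ratio of the two
  -- Gaussian binomials.
  refine hprime.pow_dvd_of_dvd_mul_left 3 (fun hd => ?_) (a := qBlockProd X h k * qBlockProd X h m) ?_
  · exact (hprime.dvd_or_dvd hd).elim (cyclotomic_not_dvd_qBlockProd h k)
      (cyclotomic_not_dvd_qBlockProd h m)
  set p := 2 * h + 1 with hp
  set Φ := cyclotomic p ℤ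
  set f := Ideal.Quotient.mk (Ideal.span {Φ ^ 3})
  rw [← Ideal.mem_span_singleton, ← Ideal.Quotient.eq_zero_iff_mem]
  change f _ = 0
  have hΦ : Φ ∣ 1 - X ^ p := (cyclotomic_dvd_one_sub_X_pow_iff (by omega) p).2 dvd_rfl
  have hf : ∀ g, Φ ^ 3 ∣ g → f g = 0 := fun g hg =>
    Ideal.Quotient.eq_zero_iff_mem.2 (Ideal.mem_span_singleton.2 hg)
  have hδ : (1 - f X ^ p) ^ 3 = 0 := by simpa using hf _ (pow_dvd_pow_of_dvd hΦ 3)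
  have hE : (1 - f X ^ p) ^ 2 * qPairDeriv (f X) h =
      (1 - f X ^ p) ^ 2 * (f (κ : ℤ[X]) * qBlock (f X) h 1) := by
    have h1 := hf _ (mul_dvd_mul (pow_dvd_pow_of_dvd hΦ 2) (cyclotomic_dvd_qPairDeriv_sub hh hκ))
    rw [← sub_eq_zero, ← mul_sub, ← h1]
    simp [qPairDeriv, qPair, qBlock]
  have hG := congrArg f (gaussBinom_mul_qBlockProd h m k)
  simp only [map_mul, map_qBlockProd] at hG
  have hc : p.choose 2 = p * h := by
    rw [Nat.choose_two_right, hp, Nat.add_sub_cancel, mul_left_comm,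
      Nat.mul_div_cancel_left _ (by norm_num)]
  rw [qBlockProd_of_cube_zero hδ hE, qBlockProd_of_cube_zero hδ hE,
    qBlockProd_of_cube_zero hδ hE, ← hp] at hG
  simp only [map_mul, map_sub, map_add, map_one, map_pow, map_natCast, map_qBlockProd]
  rw [qBlockProd_of_cube_zero hδ hE, qBlockProd_of_cube_zero hδ hE, ← hp]
  rw [choose_two_mul, hc, mul_comm k p, mul_comm m p, one_sub_mul_one_sub_of_cube_zero hδ]
  set g := f (gaussBinom (X ^ p) (m + k) k)
  set G := f (gaussBinom X (p * (m + k)) (p * k))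
  set x := f X
  set b := qBlock x h 1
  set δ := 1 - x ^ p
  have s1 := sq_mul_pow_of_cube_zero hδ (h * k.choose 2)
  have s2 := sq_mul_pow_of_cube_zero hδ (h * m.choose 2)
  have s3 := sq_mul_pow_of_cube_zero hδ (k ^ 2 * h + k.choose 2)
  have s4 := sq_mul_pow_of_cube_zero hδ ((m + k) * k * h + k.choose 2)
  have e1 : x ^ (k ^ 2 * (p * h) + p * k.choose 2) = x ^ (p * (k ^ 2 * h + k.choose 2)) := by
    congr 1; ring
  have e2 : x ^ ((m + k) * k * (p * h) + p * k.choose 2) =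
      x ^ (p * ((m + k) * k * h + k.choose 2)) := by
    congr 1; ring
  -- Equality of the leading terms; it forces the exponent n k (p choose 2) on the right side of the
  -- congruence.
  have e3 : x ^ (p * (k ^ 2 * h + k.choose 2)) * x ^ (p * (h * (m + k).choose 2)) =
      x ^ (p * ((m + k) * k * h + k.choose 2)) * x ^ (p * (h * k.choose 2)) *
        x ^ (p * (h * m.choose 2)) := by
    rw [← pow_add, ← pow_add, ← pow_add, choose_two_add]; congr 1; ring
  rw [sumPronic_add] at hG
  rw [e1, e2]
  push_cast at hG ⊢
  generalize x ^ (p * (k ^ 2 * h + k.choose 2)) = Y at *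
  generalize x ^ (p * ((m + k) * k * h + k.choose 2)) = Z at *
  generalize x ^ (p * (h * k.choose 2)) = U at *
  generalize x ^ (p * (h * m.choose 2)) = V at *
  generalize x ^ (p * (h * (m + k).choose 2)) = W at *
  linear_combination Y * hG + b ^ (m + k) * g * (e3 +
    (f κ) * (sumPronic k + sumPronic m + (m + k) * k * m) * s3 -
    (f κ) * sumPronic k * (Z * s2 + s4) - (f κ) * sumPronic m * (Z * s1 + s4) -
    (f κ) * (m + k) * k * m * (V * s1 + s2) -
    (f κ) ^ 2 * sumPronic k * sumPronic m * Z * δ * hδ -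
    (f κ) ^ 2 * (m + k) * k * m * (sumPronic k * V + sumPronic m * U +
      f κ * sumPronic k * sumPronic m * δ ^ 2) * δ * hδ)

end Coefficientwise

/-! ### Divisibility of the three sums and of the q-factorial -/

section Lacunary

/-- For j ≥ 1, Φ_{p^j}(q^p) = Φ_{p^(j+1)}(q). -/
theorem cycloLike_X_pow_cyclotomic {p j : ℕ} (hp : p.Prime) (hj : 1 ≤ j) :
    CycloLike ((X : ℤ[X]) ^ p) (cyclotomic (p ^ (j + 1)) ℤ) (p ^ j) := by
  have h := (cycloLike_cyclotomic (pow_pos hp.pos j)).map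
    (expand ℤ p : ℤ[X] →ₐ[ℤ] ℤ[X]).toRingHom
  have h1 := cyclotomic_expand_eq_cyclotomic hp (dvd_pow_self p (show j ≠ 0 by omega)) ℤ
  rw [← pow_succ] at h1
  simpa [h1] using h

/-- The summand of the left side of the `q`-congruence, without its weight. -/
noncomputable def coeffLeft (p n k : ℕ) : ℤ[X] :=
  (-1) ^ k * X ^ (k * p).choose 2 * gaussBinom X (p * n) (p * k)

/-- The summand of the first sum on the right side, without its weight. -/
noncomputable def coeffMain (p n k : ℕ) : ℤ[X] :=
  (-1) ^ k * X ^ (n * k * p.choose 2 + p * k.choose 2) * gaussBinom (X ^ p) n k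

/-- The summand of the second sum on the right side, without its weight. -/
noncomputable def coeffCorr (p n k : ℕ) : ℤ[X] :=
  (-1) ^ k * (1 - X ^ (k * p)) * (1 - X ^ ((n - k) * p)) * gaussBinom (X ^ p) n k

/-- The summand of the right side, without its weight, where `κ` stands for `(p ^ 2 - 1) / 24`. -/
noncomputable def coeffRight (κ : ℤ) (p n k : ℕ) : ℤ[X] :=
  coeffMain p n k + (κ : ℤ[X]) * (n : ℤ[X]) * coeffCorr p n k

theorem lacunary_mul {p : ℕ} (hp : 0 < p) (n c : ℕ) (r : ℤ) :
    lacunary (p * n) (p * c) (p * r) ⊇ (lacunary n c r).image (p * ·) ∧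
      ∀ K ∈ lacunary (p * n) (p * c) (p * r), K ∈ (lacunary n c r).image (p * ·) := by
  have hp0 : (p : ℤ) ≠ 0 := by exact_mod_cast hp.ne'
  have key : ∀ k : ℕ, ((p * k : ℕ) : ℤ) ≡ p * r [ZMOD ((p * c : ℕ) : ℤ)] ↔
      (k : ℤ) ≡ r [ZMOD (c : ℤ)] := by
    intro k
    push_cast
    rw [Int.modEq_iff_dvd, Int.modEq_iff_dvd, ← mul_sub, mul_dvd_mul_iff_left hp0]
  constructor
  · intro K hK
    obtain ⟨k, hk, rfl⟩ := mem_image.1 hK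
    obtain ⟨h1, h2⟩ := mem_filter.1 hk
    refine mem_filter.2 ⟨mem_range.2 ?_, (key k).2 h2⟩
    have := Nat.mul_le_mul_left p (Nat.lt_succ_iff.1 (mem_range.1 h1))
    exact Nat.lt_succ_iff.2 this
  · intro K hK
    obtain ⟨h1, h2⟩ := mem_filter.1 hK
    have h3 : p ∣ K := by
      have h4 := (Int.modEq_iff_dvd.1 h2)
      push_cast at h4
      have h5 := (dvd_mul_right (p : ℤ) c).trans h4
      rw [dvd_sub_right (dvd_mul_right _ _)] at h5
      exact_mod_cast h5
    obtain ⟨k, rfl⟩ := h3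
    refine mem_image.2 ⟨k, mem_filter.2 ⟨mem_range.2 ?_, (key k).1 h2⟩, rfl⟩
    exact Nat.lt_succ_iff.2 (Nat.le_of_mul_le_mul_left (Nat.lt_succ_iff.1 (mem_range.1 h1)) hp)

theorem sum_lacunary_mul {M : Type*} [AddCommMonoid M] {p : ℕ} (hp : 0 < p) (n c : ℕ) (r : ℤ)
    (f : ℕ → M) :
    ∑ K ∈ lacunary (p * n) (p * c) (p * r), f K = ∑ k ∈ lacunary n c r, f (p * k) := by
  rw [Subset.antisymm (lacunary_mul hp n c r).2 (lacunary_mul hp n c r).1, sum_image]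
  exact fun a _ b _ h => Nat.eq_of_mul_eq_mul_left hp h

theorem odd_of_prime_of_five_le {p : ℕ} (hp : p.Prime) (hp5 : 5 ≤ p) : Odd p := hp.odd_of_ne_two (by omega)

/-- With K = pk this is a lacunary sum of length pn over K ≡ pr modulo p^(α+1), a divisor of p^j. -/
theorem pow_dvd_sum_coeffLeft {p : ℕ} (hp : p.Prime) (hp5 : 5 ≤ p) {α j : ℕ}
    (hj : α + 1 ≤ j) (n i : ℕ) (r : ℤ) :
    cyclotomic (p ^ j) ℤ ^ (n / p ^ j) ∣
      ∑ k ∈ lacunary n (p ^ α) r, coeffLeft p n k * X ^ (p * k * i) := by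
  have hodd := odd_of_prime_of_five_le hp hp5
  have h := (cycloLike_cyclotomic (pow_pos hp.pos j)).pow_dvd_lacunary_sum (hodd.pow)
    (pow_dvd_pow p hj) (p * n) i (p * r)
  rw [pow_succ', sum_lacunary_mul hp.pos] at h
  refine (pow_dvd_pow _ (Nat.div_le_div_right (Nat.le_mul_of_pos_left n hp.pos))).trans
    (h.trans (dvd_of_eq (sum_congr rfl fun k _ => ?_)))
  rw [coeffLeft, pow_mul (-1 : ℤ[X]), hodd.neg_one_pow, mul_comm k p, mul_comm i]

/-- In base q^p the extra power q^(nk (p choose 2)) is absorbed by shifting i to nh + i, where p =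
2h + 1. -/
theorem pow_dvd_sum_coeffMain {p : ℕ} (hp : p.Prime) (hp5 : 5 ≤ p) {α j : ℕ} (hα : 1 ≤ α)
    (hj : α + 1 ≤ j) (n i : ℕ) (r : ℤ) :
    cyclotomic (p ^ j) ℤ ^ (n / p ^ j) ∣
      ∑ k ∈ lacunary n (p ^ α) r, coeffMain p n k * X ^ (p * k * i) := by
  obtain ⟨j, rfl⟩ : ∃ a, j = a + 1 := ⟨j - 1, by omega⟩
  have hodd := odd_of_prime_of_five_le hp hp5
  obtain ⟨h, hh⟩ := hodd
  have hc : p.choose 2 = p * h := by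
    rw [Nat.choose_two_right, hh, Nat.add_sub_cancel, mul_left_comm,
      Nat.mul_div_cancel_left _ (by norm_num)]
  have h := (cycloLike_X_pow_cyclotomic hp (show 1 ≤ j by omega)).pow_dvd_lacunary_sum
    (Odd.pow ⟨h, hh⟩) (pow_dvd_pow p (show α ≤ j by omega)) n (n * h + i) r
  refine (pow_dvd_pow _ (Nat.div_le_div_left (Nat.pow_le_pow_right hp.pos j.le_succ)
    (pow_pos hp.pos j))).trans (h.trans (dvd_of_eq (sum_congr rfl fun k _ => ?_)))
  rw [coeffMain, hc]
  simp only [← pow_mul]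
  ring

theorem pow_dvd_sum_coeffCorr {p : ℕ} (hp : p.Prime) (hp5 : 5 ≤ p) {α j : ℕ} (hα : 1 ≤ α)
    (hj : α + 1 ≤ j) (n i : ℕ) (r : ℤ) :
    cyclotomic (p ^ j) ℤ ^ (n / p ^ j) ∣
      ∑ k ∈ lacunary n (p ^ α) r, coeffCorr p n k * X ^ (p * k * i) := by
  obtain ⟨j, rfl⟩ : ∃ a, j = a + 1 := ⟨j - 1, by omega⟩
  have hodd := odd_of_prime_of_five_le hp hp5
  -- The slack 4 ≤ p makes up for the slower gain of factors in Rogers–Szegő polynomials.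
  have he : 4 * p ^ j * (n / p ^ (j + 1)) ≤ n := by
    refine le_trans (Nat.mul_le_mul_right _ ?_) (Nat.mul_div_le n (p ^ (j + 1)))
    rw [pow_succ']
    exact Nat.mul_le_mul_right _ (by omega)
  have h := (cycloLike_X_pow_cyclotomic hp (show 1 ≤ j by omega)).pow_dvd_lacunary_sum'
    hodd.pow (pow_dvd_pow p (show α ≤ j by omega)) n i _ he r
  refine h.trans (dvd_of_eq (sum_congr rfl fun k _ => ?_))
  rw [coeffCorr, mul_comm k p, mul_comm (n - k) p]
  simp only [← pow_mul]
  ring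

theorem pow_dvd_sum_coeffRight {p : ℕ} (hp : p.Prime) (hp5 : 5 ≤ p) {α j : ℕ} (hα : 1 ≤ α)
    (hj : α + 1 ≤ j) (n i : ℕ) (r : ℤ) (κ : ℤ) :
    cyclotomic (p ^ j) ℤ ^ (n / p ^ j) ∣
      ∑ k ∈ lacunary n (p ^ α) r, coeffRight κ p n k * X ^ (p * k * i) := by
  have h := dvd_add (pow_dvd_sum_coeffMain hp hp5 hα hj n i r)
    ((pow_dvd_sum_coeffCorr hp hp5 hα hj n i r).mul_left ((κ : ℤ[X]) * (n : ℤ[X])))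
  rw [mul_sum, ← sum_add_distrib] at h
  refine h.trans (dvd_of_eq (sum_congr rfl fun k _ => ?_))
  rw [coeffRight]
  ring

theorem dvd_sum_mul_sub_pow {R : Type*} [CommRing R] {u : R} {s : Finset ℕ} {c y : ℕ → R}
    (h : ∀ i, u ∣ ∑ k ∈ s, c k * y k ^ i) (a b : R) (l : ℕ) :
    u ∣ ∑ k ∈ s, c k * (a - b * y k) ^ l := by
  have h1 : ∀ k, c k * (a - b * y k) ^ l = ∑ i ∈ range (l + 1),
      (a ^ (l - i) * (-b) ^ i * (l.choose i : R)) * (c k * y k ^ i) := by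
    intro k
    rw [sub_eq_add_neg, ← neg_mul, add_comm, add_pow, mul_sum]
    exact sum_congr rfl fun i _ => by ring
  simp only [h1]
  rw [sum_comm]
  refine Finset.dvd_sum fun i _ => ?_
  rw [← mul_sum]
  exact (h i).mul_left _

/-- The denominator of `clearFactor`. -/
noncomputable def clearDen (p α n : ℕ) : ℤ[X] := ∏ j ∈ Icc (α + 1) n, cyclotomic (p ^ j) ℤ ^ (n / p ^ j)

theorem clearDen_dvd {p : ℕ} (hp : p.Prime) {α n : ℕ} {f : ℤ[X]}
    (h : ∀ j ∈ Icc (α + 1) n, cyclotomic (p ^ j) ℤ ^ (n / p ^ j) ∣ f) : clearDen p α n ∣ f := by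
  refine Finset.prod_dvd_of_isRelPrime (fun i _ j _ hij => ?_) h
  refine IsRelPrime.pow ?_
  have hi := pow_pos hp.pos i
  rw [(cyclotomic.irreducible hi).isRelPrime_iff_not_dvd]
  intro hd
  have h1 := (cyclotomic.irreducible hi).associated_of_dvd
    (cyclotomic.irreducible (pow_pos hp.pos j)) hd
  have h2 := eq_of_monic_of_associated (cyclotomic.monic _ _) (cyclotomic.monic _ _) h1
  exact hij (Nat.pow_right_injective hp.two_le (cyclotomic_injective h2))

/-- Powers of 1 - q^(p^α) may be cancelled: Φ_{p^j} does not divide it when j > α. -/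
theorem clearDen_dvd_of_mul {p : ℕ} (hp : p.Prime) {α n N : ℕ} {f : ℤ[X]}
    (h : ∀ j ∈ Icc (α + 1) n, cyclotomic (p ^ j) ℤ ^ (n / p ^ j) ∣ (1 - X ^ p ^ α) ^ N * f) :
    clearDen p α n ∣ f := by
  refine clearDen_dvd hp fun j hj => ?_
  have hj' := (mem_Icc.1 hj).1
  have hpos := pow_pos hp.pos j
  refine (prime_cyclotomic hpos).pow_dvd_of_dvd_mul_left _ (fun hd => ?_) (h j hj)
  have h1 := (cyclotomic_dvd_one_sub_X_pow_iff hpos _).1 ((prime_cyclotomic hpos).dvd_of_dvd_pow hd)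
  rw [Nat.pow_dvd_pow_iff_le_right hp.one_lt] at h1
  omega

theorem clearDen_eval_one {p : ℕ} (hp : p.Prime) (α n : ℕ) :
    (clearDen p α n).eval 1 = (p : ℤ) ^ ∑ j ∈ Icc (α + 1) n, n / p ^ j := by
  have := Fact.mk hp
  rw [clearDen, eval_prod, ← prod_pow_eq_pow_sum]
  refine prod_congr rfl fun j hj => ?_
  obtain ⟨j, rfl⟩ : ∃ a, j = a + 1 := ⟨j - 1, by have := (mem_Icc.1 hj).1; omega⟩
  rw [eval_pow, eval_one_cyclotomic_prime_pow]

theorem not_dvd_clearDen {p : ℕ} (hp : p.Prime) {α : ℕ} (hα : 1 ≤ α) (n : ℕ) :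
    ¬ cyclotomic p ℤ ∣ clearDen p α n := by
  intro h
  rw [clearDen, (prime_cyclotomic hp.pos).dvd_finsetProd_iff] at h
  obtain ⟨j, hj, h⟩ := h
  have hj' := (mem_Icc.1 hj).1
  have hpos := pow_pos hp.pos j
  have h1 := (cyclotomic.irreducible hp.pos).associated_of_dvd (cyclotomic.irreducible hpos)
    ((prime_cyclotomic hp.pos).dvd_of_dvd_pow h)
  have h2 := cyclotomic_injective
    (eq_of_monic_of_associated (cyclotomic.monic _ _) (cyclotomic.monic _ _) h1)
  have h3 : p ^ 1 = p ^ j := by simpa using h2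
  have := Nat.pow_right_injective hp.two_le h3
  omega

/-- The `q`-factorial as a polynomial in `q ^ c`. -/
noncomputable def qFactPoly (c N : ℕ) : ℤ[X] := ∏ i ∈ range N, ∑ t ∈ range (i + 1), (X ^ c) ^ t

theorem one_sub_pow_mul_qFactPoly (c N : ℕ) :
    (1 - X ^ c) ^ N * qFactPoly c N = ∏ i ∈ range N, (1 - X ^ c * (X ^ c) ^ i) := by
  have h : (1 - (X : ℤ[X]) ^ c) ^ N = ∏ _i ∈ range N, (1 - X ^ c) := by simp
  rw [h, qFactPoly, ← prod_mul_distrib]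
  refine prod_congr rfl fun i _ => ?_
  rw [mul_neg_geom_sum, pow_succ']

theorem clearDen_dvd_qFactPoly {p : ℕ} (hp : p.Prime) (hp5 : 5 ≤ p) (α n : ℕ) :
    clearDen p α n ∣ qFactPoly (p ^ α) (n / p ^ α) := by
  refine clearDen_dvd_of_mul hp (N := n / p ^ α) fun j hj => ?_
  rw [one_sub_pow_mul_qFactPoly]
  obtain ⟨s, rfl⟩ := Nat.exists_eq_add_of_le (mem_Icc.1 hj).1
  have hs := pow_pos hp.pos (s + 1)
  have h := (cycloLike_cyclotomic hs).pow_dvd_prod (odd_of_prime_of_five_le hp hp5).pow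
    (n / p ^ α) (y := X) ((cyclotomic_dvd_one_sub_X_pow_iff hs _).2 dvd_rfl)
  have h1 := map_dvd (expand ℤ (p ^ α)) h
  have h2 : expand ℤ (p ^ α) (cyclotomic (p ^ (s + 1)) ℤ) = cyclotomic (p ^ (α + 1 + s)) ℤ := by
    have key : ∀ a, expand ℤ (p ^ a) (cyclotomic (p ^ (s + 1)) ℤ) =
        cyclotomic (p ^ (a + 1 + s)) ℤ := by
      intro a
      induction a with
      | zero => simp [add_comm]
      | succ a ih =>
        rw [pow_succ', expand_mul, ih,
          cyclotomic_expand_eq_cyclotomic hp (dvd_pow_self p (by omega)), ← pow_succ]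
        congr 2; ring
    exact key α
  rw [map_pow, h2, Nat.div_div_eq_div_mul, ← pow_add, show α + (s + 1) = α + 1 + s by ring] at h1
  simpa using h1

theorem qFactPoly_eval_one (c N : ℕ) : (qFactPoly c N).eval 1 = (N.factorial : ℤ) := by
  rw [qFactPoly, eval_prod, ← prod_range_add_one_eq_factorial]
  push_cast
  exact prod_congr rfl fun i _ => by simp [eval_finsetSum]

/-- By Legendre's formula the exponent of p in `clearDen` at 1 already exhausts the p-adic valuation
of N!. -/
theorem not_dvd_eval_of_mul_clearDen {p : ℕ} (hp : p.Prime) {α n : ℕ} {F : ℤ[X]}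
    (hF : clearDen p α n * F = qFactPoly (p ^ α) (n / p ^ α)) : ¬ (p : ℤ) ∣ F.eval 1 := by
  have := Fact.mk hp
  have h := congrArg (eval 1) hF
  rw [eval_mul, clearDen_eval_one hp, qFactPoly_eval_one] at h
  intro hd
  have h1 : p ^ ((∑ j ∈ Icc (α + 1) n, n / p ^ j) + 1) ∣ (n / p ^ α).factorial := by
    rw [← Int.natCast_dvd_natCast, ← h]
    push_cast
    rw [pow_succ]
    exact mul_dvd_mul_left _ hd
  rw [padicValNat_dvd_iff_le (Nat.factorial_ne_zero _)] at h1
  have hlog : Nat.log p (n / p ^ α) < n + 1 :=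
    Nat.lt_succ_iff.2 ((Nat.log_le_self _ _).trans (Nat.div_le_self _ _))
  rw [padicValNat_factorial hlog] at h1
  have h2 : ∑ i ∈ Ico 1 (n + 1), n / p ^ α / p ^ i ≤ ∑ j ∈ Icc (α + 1) n, n / p ^ j := by
    calc ∑ i ∈ Ico 1 (n + 1), n / p ^ α / p ^ i
        = ∑ j ∈ (Ico 1 (n + 1)).image (α + ·), n / p ^ j := by
          rw [sum_image (fun a _ b _ h => Nat.add_left_cancel h)]
          exact sum_congr rfl fun i _ => by rw [Nat.div_div_eq_div_mul, pow_add]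
      _ ≤ _ := by
          refine sum_le_sum_of_ne_zero fun j hj hne => ?_
          obtain ⟨i, hi, rfl⟩ := mem_image.1 hj
          have hi' := mem_Ico.1 hi
          refine mem_Icc.2 ⟨by omega, ?_⟩
          by_contra hlt
          refine hne (Nat.div_eq_of_lt ?_)
          exact (not_le.1 hlt).trans (Nat.lt_pow_self hp.one_lt)
  omega

theorem exists_one_sub_X_pow_mul (a b c : ℕ) (h : a ≡ b [MOD c]) :
    ∃ w : ℤ[X], (1 - X ^ c) * w = X ^ a - X ^ b := by
  have key : ∀ a b : ℕ, a ≤ b → a ≡ b [MOD c] → (1 - (X : ℤ[X]) ^ c) ∣ X ^ a - X ^ b := by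
    intro a b hab h
    obtain ⟨s, hs⟩ := (Nat.modEq_iff_dvd' hab).1 h
    obtain rfl : b = a + c * s := by omega
    rw [pow_add, pow_mul, ← mul_one_sub]
    exact (dvd_one_sub_pow_of_dvd dvd_rfl s).mul_left _
  rcases le_total a b with hab | hab
  · obtain ⟨w, hw⟩ := key a b hab h
    exact ⟨w, hw.symm⟩
  · obtain ⟨w, hw⟩ := key b a hab h.symm
    exact ⟨-w, by linear_combination hw⟩

/-- L'Hôpital's rule: differentiate and set q = 1. -/
theorem eval_one_of_one_sub_X_pow_mul {a b c : ℕ} {w : ℤ[X]}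
    (h : (1 - X ^ c) * w = X ^ a - X ^ b) : (c : ℤ) * w.eval 1 = b - a := by
  have h1 := congrArg (fun f => eval 1 (derivative f)) h
  simp [derivative_mul, derivative_X_pow] at h1
  linarith

end Lacunary

/-! ### From integer polynomials to rational functions and to q = 1 -/

section Bridge

theorem qInt_natCast {K : Type*} [Field K] {q : K} (hq : q ≠ 1) (m : ℕ) :
    qInt q (m : ℤ) = ∑ t ∈ range m, q ^ t := by
  rw [qInt, div_eq_iff (sub_ne_zero.2 hq.symm), mul_comm, mul_neg_geom_sum, zpow_natCast]

theorem qFact_eq_qPoch {K : Type*} [Field K] (q : K) (n : ℕ) :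
    qFact q n = qPoch q n / (1 - q) ^ n := by
  rw [qFact, qPoch]
  simp only [qInt]
  rw [prod_div_distrib, prod_const, card_range]
  norm_cast

theorem qBinom_eq_gaussBinom {K : Type*} [Field K] {q : K} (hq : ∀ i : ℕ, q ^ (i + 1) ≠ 1)
    {n k : ℕ} (hk : k ≤ n) : qBinom q n k = gaussBinom q n k := by
  obtain ⟨m, rfl⟩ := Nat.exists_eq_add_of_le' hk
  have hP : ∀ j, qPoch q j ≠ 0 := fun j =>
    prod_ne_zero_iff.2 fun i _ => sub_ne_zero.2 (hq i).symm
  have h1 : (1 - q) ≠ 0 := sub_ne_zero.2 (by simpa using (hq 0).symm)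
  have h2 : (∏ i ∈ range k, qInt q (((m + k : ℕ) : ℤ) - (i : ℤ))) * qPoch q m =
      qPoch q (m + k) / (1 - q) ^ k := by
    have h3 : ∀ i ∈ range k, qInt q (((m + k : ℕ) : ℤ) - (i : ℤ)) =
        (1 - q ^ (m + (k - 1 - i) + 1)) / (1 - q) := by
      intro i hi
      have := mem_range.1 hi
      rw [qInt, ← zpow_natCast q]
      congr 3
      omega
    rw [prod_congr rfl h3, prod_div_distrib, prod_const, card_range,
      prod_range_reflect (fun i => 1 - q ^ (m + i + 1)), qPoch, qPoch, prod_range_add]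
    ring
  rw [← gaussBinom_mul_qPoch] at h2
  rw [qBinom, qFact_eq_qPoch, div_eq_iff (div_ne_zero (hP k) (pow_ne_zero _ h1))]
  apply mul_right_cancel₀ (hP m)
  rw [h2]
  ring

/-- The inclusion of `ℤ[q]` in `ℚ(q)` as a ring homomorphism. -/
noncomputable def toRatFuncHom : ℤ[X] →+* RatFunc ℚ :=
  (algebraMap ℚ[X] (RatFunc ℚ)).comp (mapRingHom (Int.castRingHom ℚ))

theorem toRatFunc_eq (f : ℤ[X]) : toRatFunc f = toRatFuncHom f := rfl

theorem toRatFuncHom_injective : Function.Injective toRatFuncHom :=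
  (IsFractionRing.injective ℚ[X] (RatFunc ℚ)).comp (map_injective _ Int.cast_injective)

theorem toRatFuncHom_ne_zero {f : ℤ[X]} (hf : f ≠ 0) : toRatFuncHom f ≠ 0 :=
  (map_ne_zero_iff _ toRatFuncHom_injective).2 hf

theorem toRatFuncHom_X : toRatFuncHom X = qVar := by
  simp [toRatFuncHom, qVar, RatFunc.algebraMap_X]

theorem qVar_ne_zero : qVar ≠ 0 := RatFunc.X_ne_zero

theorem qVar_pow_ne_one {a : ℕ} (ha : 0 < a) : qVar ^ a ≠ 1 := by
  rw [← toRatFuncHom_X, ← map_pow, ← map_one toRatFuncHom]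
  intro h
  have := congrArg natDegree (toRatFuncHom_injective h)
  rw [natDegree_one, natDegree_X_pow] at this
  omega

theorem one_sub_qVar_pow_ne_zero {a : ℕ} (ha : 0 < a) : 1 - qVar ^ a ≠ 0 :=
  sub_ne_zero.2 (qVar_pow_ne_one ha).symm

theorem qBinom_qVar_pow {a : ℕ} (ha : 0 < a) {n k : ℕ} (hk : k ≤ n) :
    qBinom (qVar ^ a) n k = toRatFuncHom (gaussBinom (X ^ a) n k) := by
  rw [map_gaussBinom, map_pow, toRatFuncHom_X]
  refine qBinom_eq_gaussBinom (fun i => ?_) hk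
  rw [← pow_mul]
  exact qVar_pow_ne_one (by positivity)

theorem qFact_qVar_pow {a : ℕ} (ha : 0 < a) (n : ℕ) :
    qFact (qVar ^ a) n = toRatFuncHom (qFactPoly a n) := by
  rw [qFact, qFactPoly, map_prod]
  refine prod_congr rfl fun i _ => ?_
  have := qInt_natCast (qVar_pow_ne_one ha) (i + 1)
  push_cast at this
  rw [this, map_sum]
  simp only [map_pow, toRatFuncHom_X]

theorem qInt_qVar_pow_prime {p : ℕ} (hp : p.Prime) (j : ℕ) :
    qInt (qVar ^ p ^ j) (p : ℤ) = toRatFuncHom (cyclotomic (p ^ (j + 1)) ℤ) := by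
  rw [qInt_natCast (qVar_pow_ne_one (pow_pos hp.pos j)), cyclotomic_prime_pow_eq_geom_sum hp,
    map_sum]
  simp only [map_pow, toRatFuncHom_X]

theorem qFactPoly_ne_zero (c N : ℕ) : qFactPoly c N ≠ 0 := by
  intro h
  have := congrArg (eval 1) h
  rw [qFactPoly_eval_one, eval_zero] at this
  exact Nat.factorial_ne_zero N (by exact_mod_cast this)

theorem clearDen_ne_zero (p α n : ℕ) : clearDen p α n ≠ 0 :=
  prod_ne_zero_iff.2 fun _ _ => pow_ne_zero _ (cyclotomic_ne_zero _ _)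

theorem clearFactor_eq {p : ℕ} (hp : p.Prime) (α n : ℕ) :
    clearFactor p α n = toRatFuncHom (qFactPoly (p ^ α) (n / p ^ α)) /
      toRatFuncHom (clearDen p α n) := by
  rw [clearFactor, qFact_qVar_pow (pow_pos hp.pos α), clearDen, map_prod]
  congr 1
  refine prod_congr rfl fun j hj => ?_
  obtain ⟨j, rfl⟩ : ∃ a, j = a + 1 := ⟨j - 1, by have := (mem_Icc.1 hj).1; omega⟩
  rw [map_pow, Nat.add_sub_cancel, qInt_qVar_pow_prime hp]

/-- A weighted lacunary sum with arbitrary coefficients `c k`. -/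
noncomputable def weightedSum (p α β n l : ℕ) (r : ℤ) (c : ℕ → ℤ[X]) : RatFunc ℚ :=
  normFactor p α n l * ∑ k ∈ lacunary n (p ^ α) r, toRatFuncHom (c k) * weight p α β l r k

theorem le_of_mem_lacunary {n c k : ℕ} {r : ℤ} (h : k ∈ lacunary n c r) : k ≤ n :=
  Nat.lt_succ_iff.1 (mem_range.1 (mem_filter.1 h).1)

theorem mul_ediv_of_mem_lacunary {n c k : ℕ} {r : ℤ} (h : k ∈ lacunary n c r) :
    (c : ℤ) * (((k : ℤ) - r) / (c : ℤ)) = k - r :=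
  Int.mul_ediv_cancel' (Int.modEq_iff_dvd.1 (mem_filter.1 h).2.symm)

theorem qLeft_eq {p : ℕ} (α β n l : ℕ) (r : ℤ) :
    qLeft p α β n l r = weightedSum p α β n l r (coeffLeft p n) := by
  rw [qLeft, weightedSum]
  congr 1
  refine sum_congr rfl fun k hk => ?_
  have h := qBinom_qVar_pow one_pos (Nat.mul_le_mul_left p (le_of_mem_lacunary hk))
  rw [pow_one, pow_one] at h
  rw [h, coeffLeft]
  simp only [map_mul, map_pow, map_neg, map_one, toRatFuncHom_X]

theorem qRight_eq {p : ℕ} (hp : p.Prime) {κ : ℤ} (hκ : 24 * κ = (p : ℤ) ^ 2 - 1)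
    (α β n l : ℕ) (r : ℤ) :
    qRight p α β n l r = weightedSum p α β n l r (coeffRight κ p n) := by
  have h24 : ((p : RatFunc ℚ) ^ 2 - 1) * (n : RatFunc ℚ) / 24 = (κ : RatFunc ℚ) * n := by
    have h : (24 : RatFunc ℚ) * κ = (p : RatFunc ℚ) ^ 2 - 1 := by
      simpa using congrArg (Int.cast : ℤ → RatFunc ℚ) hκ
    rw [← h]
    field_simp
  rw [qRight, weightedSum, h24, mul_right_comm, mul_comm _ (normFactor p α n l), ← mul_add,
    mul_sum, ← sum_add_distrib]
  congr 1
  refine sum_congr rfl fun k hk => ?_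
  rw [qBinom_qVar_pow hp.pos (le_of_mem_lacunary hk), coeffRight, coeffMain, coeffCorr]
  simp only [map_add, map_sub, map_mul, map_pow, map_neg, map_one, toRatFuncHom_X, map_intCast,
    map_natCast]
  ring

theorem dvd_coeffLeft_sub_coeffRight {p : ℕ} (hp : p.Prime) (hp5 : 5 ≤ p) {κ : ℤ}
    (hκ : 24 * κ = (p : ℤ) ^ 2 - 1) {n k : ℕ} (hk : k ≤ n) :
    cyclotomic p ℤ ^ 3 ∣ coeffLeft p n k - coeffRight κ p n k := by
  obtain ⟨h, hh⟩ := odd_of_prime_of_five_le hp hp5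
  have hκ' : 24 * κ = (2 * h + 1) ^ 2 - 1 := by rw [hκ, hh]; push_cast; ring
  refine ((cyclotomic_pow_three_dvd (by omega) hκ' hh hk).mul_left ((-1) ^ k)).trans
    (dvd_of_eq ?_)
  rw [coeffLeft, coeffRight, coeffMain, coeffCorr]
  ring

theorem fracCongr_of_dvd_sub {p : ℕ} (hp : p.Prime) {a b c : ℤ[X]} {x y : RatFunc ℚ}
    (hc : ¬ cyclotomic p ℤ ∣ c) (ha : toRatFuncHom a = toRatFuncHom c * x)
    (hb : toRatFuncHom b = toRatFuncHom c * y) (hab : cyclotomic p ℤ ^ 3 ∣ a - b) :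
    FracCongr (qIntPoly ℚ p ^ 3) x y := by
  have := Fact.mk hp
  have hc0 : c ≠ 0 := by rintro rfl; exact hc (dvd_zero _)
  have hc1 := toRatFuncHom_ne_zero hc0
  have hq : qIntPoly ℚ p = (cyclotomic p ℤ).map (Int.castRingHom ℚ) := by
    rw [map_cyclotomic, cyclotomic_prime, qIntPoly]
  refine ⟨a.map (Int.castRingHom ℚ), b.map (Int.castRingHom ℚ), c.map (Int.castRingHom ℚ),
    (Polynomial.map_ne_zero_iff Int.cast_injective).2 hc0, ?_,
    (eq_div_iff hc1).2 (by rw [mul_comm]; exact ha.symm),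
    (eq_div_iff hc1).2 (by rw [mul_comm]; exact hb.symm), ?_⟩
  · refine IsCoprime.pow_right (IsCoprime.symm ?_)
    rw [hq]
    refine (Irreducible.coprime_iff_not_dvd ?_).2 ?_
    · rw [map_cyclotomic]; exact cyclotomic.irreducible_rat hp.pos
    · rwa [map_dvd_map _ Int.cast_injective (cyclotomic.monic p ℤ)]
  · rw [hq, ← Polynomial.map_pow, ← Polynomial.map_sub]
    exact Polynomial.map_dvd _ hab

/-- Since (k - r)/p^α ≥ -max(r, 0), one power of q, independent of k, removes every negative
exponent. -/
theorem exists_weight_numerator {p : ℕ} (hp : p.Prime) (α β : ℕ) (r : ℤ) (k : ℕ) :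
    ∃ v : ℤ[X], ∀ l, toRatFuncHom (v ^ l) =
      qVar ^ (p ^ β * r.toNat * l) * weight p α β l r k := by
  have hpos := pow_pos hp.pos β
  have hm : 0 ≤ (r.toNat : ℤ) + ((k : ℤ) - r) / ((p ^ α : ℕ) : ℤ) := by
    have h1 : -(r.toNat : ℤ) ≤ ((k : ℤ) - r) / ((p ^ α : ℕ) : ℤ) := by
      have hα : (1 : ℤ) ≤ ((p ^ α : ℕ) : ℤ) := by exact_mod_cast pow_pos hp.pos α
      rw [Int.le_ediv_iff_mul_le (by omega)]
      have h2 : -(r.toNat : ℤ) * ((p ^ α : ℕ) : ℤ) ≤ -(r.toNat : ℤ) * 1 :=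
        mul_le_mul_of_nonpos_left hα (by omega)
      omega
    omega
  obtain ⟨s, hs⟩ := Int.eq_ofNat_of_zero_le hm
  obtain ⟨v, hv⟩ := exists_one_sub_X_pow_mul (p ^ β * r.toNat) (p ^ β * s) (p ^ β)
    (((Nat.modEq_zero_iff_dvd).2 (dvd_mul_right _ _)).trans
      ((Nat.modEq_zero_iff_dvd).2 (dvd_mul_right _ _)).symm)
  refine ⟨v, fun l => ?_⟩
  have h0 := one_sub_qVar_pow_ne_zero hpos
  have h1 := congrArg toRatFuncHom hv
  simp only [map_mul, map_sub, map_pow, map_one, toRatFuncHom_X] at h1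
  have h2 : qVar ^ (p ^ β * s) = qVar ^ (p ^ β * r.toNat) *
      (qVar ^ p ^ β) ^ (((k : ℤ) - r) / ((p ^ α : ℕ) : ℤ)) := by
    rw [pow_mul, pow_mul, ← zpow_natCast (qVar ^ p ^ β), ← zpow_natCast (qVar ^ p ^ β) r.toNat,
      ← zpow_add₀ (pow_ne_zero _ qVar_ne_zero), hs]
  rw [weight, pow_mul, ← mul_pow, map_pow, qInt]
  congr 1
  rw [mul_div_assoc', eq_div_iff h0, mul_comm, h1, h2]
  ring

/-- The denominator 1 - q^(p^(α+1)) of the weight cancels against the numerator of [p], leaving (1 -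
q^(p(k-r)))/(1 - q^(p^α)), affine in q^(pk). Splitting r into positive and negative parts keeps the
exponents natural. -/
theorem exists_scaled_weight_numerator {p α n : ℕ} (hp : p.Prime) {r : ℤ} {k : ℕ}
    (hk : k ∈ lacunary n (p ^ α) r) :
    ∃ w : ℤ[X], (1 - X ^ p ^ α) * w = X ^ (p * r.toNat) - X ^ (p * (-r).toNat) * X ^ (p * k) ∧
      (p : ℤ) ^ α * w.eval 1 = p * (k - r) ∧
      ∀ l, toRatFuncHom (w ^ l) =
        qVar ^ (p * l * r.toNat) * (qInt (qVar ^ p ^ α) (p : ℤ) ^ l * weight p α (α + 1) l r k) := by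
  have hr : (r.toNat : ℤ) - (-r).toNat = r := by omega
  have hm := mul_ediv_of_mem_lacunary hk
  have hmod : p * r.toNat ≡ p * (-r).toNat + p * k [MOD p ^ α] := by
    rw [← mul_add]
    refine Nat.ModEq.mul_left p ((Nat.modEq_iff_dvd).2 ⟨((k : ℤ) - r) / ((p ^ α : ℕ) : ℤ), ?_⟩)
    rw [hm]
    push_cast
    omega
  obtain ⟨w, hw⟩ := exists_one_sub_X_pow_mul _ _ _ hmod
  refine ⟨w, by rw [hw, pow_add], ?_, fun l => ?_⟩
  · have := eval_one_of_one_sub_X_pow_mul hw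
    push_cast at this
    rw [this]
    linear_combination -(p : ℤ) * hr
  have h0 := one_sub_qVar_pow_ne_zero (pow_pos hp.pos α)
  have h0' := one_sub_qVar_pow_ne_zero (pow_pos hp.pos (α + 1))
  have h1 := congrArg toRatFuncHom hw
  simp only [map_mul, map_sub, map_pow, map_one, toRatFuncHom_X] at h1
  have h2 : qVar ^ (p * (-r).toNat + p * k) = qVar ^ (p * r.toNat) *
      (qVar ^ p ^ (α + 1)) ^ (((k : ℤ) - r) / ((p ^ α : ℕ) : ℤ)) := by
    rw [← zpow_natCast, ← zpow_natCast, ← zpow_natCast, ← zpow_mul, ← zpow_add₀ qVar_ne_zero]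
    congr 1
    push_cast at hm ⊢
    linear_combination -(p : ℤ) * hm - (p : ℤ) * hr
  have h3 : qInt (qVar ^ p ^ α) (p : ℤ) = (1 - qVar ^ p ^ (α + 1)) / (1 - qVar ^ p ^ α) := by
    rw [qInt, zpow_natCast, ← pow_mul, pow_succ]
  rw [mul_right_comm, pow_mul, weight, ← mul_pow, ← mul_pow, map_pow, h3, qInt]
  congr 1
  apply mul_left_cancel₀ h0
  rw [h1, h2]
  field_simp

theorem clear_weightedSum {p : ℕ} (hp : p.Prime) (α β n l : ℕ) (r : ℤ) {v : ℕ → ℤ[X]}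
    (hv : ∀ k l, toRatFuncHom (v k ^ l) = qVar ^ (p ^ β * r.toNat * l) * weight p α β l r k)
    (c : ℕ → ℤ[X]) :
    toRatFuncHom (cyclotomic (p ^ (α + 1)) ℤ ^ l *
      ∑ k ∈ lacunary n (p ^ α) r, c k * v k ^ l) =
    toRatFuncHom (qFactPoly (p ^ α) (n / p ^ α) * X ^ (p ^ β * r.toNat * l)) *
      weightedSum p α β n l r c := by
  have h0 := toRatFuncHom_ne_zero (qFactPoly_ne_zero (p ^ α) (n / p ^ α))
  rw [weightedSum, normFactor, qFact_qVar_pow (pow_pos hp.pos α), qInt_qVar_pow_prime hp, map_mul,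
    map_mul, map_sum, map_pow, map_pow, toRatFuncHom_X]
  have h1 : ∀ a y P S : RatFunc ℚ, a ≠ 0 → a * y * (P / a * S) = P * (y * S) :=
    fun a y P S ha => by field_simp
  rw [h1 _ _ _ _ h0]
  congr 1
  rw [mul_sum]
  refine sum_congr rfl fun k _ => ?_
  rw [map_mul, hv]
  ring

/-- At a primitive p-th root ζ one has ζ^(p^α) = 1, so the q-factorial takes the value N!. -/
theorem cyclotomic_not_dvd_qFactPoly {p : ℕ} (hp : p.Prime) {α : ℕ} (hα : 1 ≤ α) (N : ℕ) :
    ¬ cyclotomic p ℤ ∣ qFactPoly (p ^ α) N := by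
  have hz := Complex.isPrimitiveRoot_exp p hp.ne_zero
  rw [cyclotomic_dvd_iff hp.pos hz, qFactPoly]
  simp only [map_prod, map_sum, map_pow, aeval_X]
  rw [(hz.pow_eq_one_iff_dvd _).2 (dvd_pow_self p (by omega))]
  simp only [one_pow, sum_const, card_range, nsmul_eq_mul, mul_one]
  exact prod_ne_zero_iff.2 fun i _ => by exact_mod_cast i.succ_ne_zero

theorem fracCongr_qLeft_qRight {p : ℕ} (hp : p.Prime) (hp5 : 5 ≤ p) {κ : ℤ}
    (hκ : 24 * κ = (p : ℤ) ^ 2 - 1) {α : ℕ} (hα : 1 ≤ α) (β n l : ℕ) (r : ℤ) :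
    FracCongr (qIntPoly ℚ p ^ 3) (qLeft p α β n l r) (qRight p α β n l r) := by
  choose v hv using exists_weight_numerator hp α β r
  rw [qLeft_eq, qRight_eq hp hκ]
  refine fracCongr_of_dvd_sub hp ?_ (clear_weightedSum hp α β n l r hv _)
    (clear_weightedSum hp α β n l r hv _) ?_
  · intro hd
    rcases (prime_cyclotomic hp.pos).dvd_or_dvd hd with h | h
    · exact cyclotomic_not_dvd_qFactPoly hp hα _ h
    · have h1 := (prime_cyclotomic hp.pos).dvd_of_dvd_pow h
      rw [cyclotomic_dvd_iff hp.pos (Complex.isPrimitiveRoot_exp p hp.ne_zero), aeval_X] at h1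
      exact Complex.exp_ne_zero _ h1
  · rw [← mul_sub, ← sum_sub_distrib]
    refine (Finset.dvd_sum fun k hk => ?_).mul_left _
    rw [← sub_mul]
    exact (dvd_coeffLeft_sub_coeffRight hp hp5 hκ (le_of_mem_lacunary hk)).mul_right _

theorem exists_cleared_weightedSum {p : ℕ} (hp : p.Prime) {α n l : ℕ} {r : ℤ} {w : ℕ → ℤ[X]}
    (hw : ∀ k ∈ lacunary n (p ^ α) r,
      (1 - X ^ p ^ α) * w k = X ^ (p * r.toNat) - X ^ (p * (-r).toNat) * X ^ (p * k))
    (hw' : ∀ k ∈ lacunary n (p ^ α) r, ∀ l, toRatFuncHom (w k ^ l) =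
        qVar ^ (p * l * r.toNat) * (qInt (qVar ^ p ^ α) (p : ℤ) ^ l * weight p α (α + 1) l r k))
    {c : ℕ → ℤ[X]}
    (hc : ∀ j ∈ Icc (α + 1) n, ∀ i, cyclotomic (p ^ j) ℤ ^ (n / p ^ j) ∣
      ∑ k ∈ lacunary n (p ^ α) r, c k * X ^ (p * k * i)) :
    ∃ A : ℤ[X], clearDen p α n * A = ∑ k ∈ lacunary n (p ^ α) r, c k * w k ^ l ∧
      toRatFuncHom A =
        qVar ^ (p * l * r.toNat) * (clearFactor p α n * weightedSum p α (α + 1) n l r c) := by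
  have hdvd : clearDen p α n ∣ ∑ k ∈ lacunary n (p ^ α) r, c k * w k ^ l := by
    refine clearDen_dvd_of_mul hp (N := l) fun j hj => ?_
    have h := dvd_sum_mul_sub_pow (y := fun k => X ^ (p * k))
      (fun i => by simpa only [pow_mul] using hc j hj i)
      (X ^ (p * r.toNat)) (X ^ (p * (-r).toNat)) l
    refine h.trans (dvd_of_eq ?_)
    rw [mul_sum]
    refine sum_congr rfl fun k hk => ?_
    rw [← hw k hk, mul_pow]
    ring
  obtain ⟨A, hA⟩ := hdvd
  refine ⟨A, hA.symm, ?_⟩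
  have h0 := toRatFuncHom_ne_zero (qFactPoly_ne_zero (p ^ α) (n / p ^ α))
  have h1 := toRatFuncHom_ne_zero (clearDen_ne_zero p α n)
  have h2 := congrArg toRatFuncHom hA
  rw [map_mul, map_sum] at h2
  apply mul_left_cancel₀ h1
  rw [← h2, clearFactor_eq hp, weightedSum, normFactor, qFact_qVar_pow (pow_pos hp.pos α)]
  field_simp
  rw [mul_assoc, mul_sum, mul_sum]
  refine sum_congr rfl fun k hk => ?_
  rw [map_mul, hw' k hk]
  ring

theorem coeffLeft_eval_one (p n k : ℕ) :
    (coeffLeft p n k).eval 1 = (-1) ^ k * ((p * n).choose (p * k) : ℤ) := by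
  rw [coeffLeft, ← coe_evalRingHom, map_mul, map_gaussBinom]
  simp [gaussBinom_one]

theorem coeffRight_eval_one (κ : ℤ) (p n k : ℕ) :
    (coeffRight κ p n k).eval 1 = (-1) ^ k * (n.choose k : ℤ) := by
  rw [coeffRight, coeffMain, coeffCorr, ← coe_evalRingHom]
  simp only [map_mul, map_add, map_gaussBinom]
  simp [gaussBinom_one]

theorem eval_one_cleared {p : ℕ} (hp : p.Prime) {α n l : ℕ} {r : ℤ} {w : ℕ → ℤ[X]}
    (hw : ∀ k ∈ lacunary n (p ^ α) r, (p : ℤ) ^ α * (w k).eval 1 = p * (k - r))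
    {c : ℕ → ℤ[X]} {A F : ℤ[X]}
    (hA : clearDen p α n * A = ∑ k ∈ lacunary n (p ^ α) r, c k * w k ^ l)
    (hF : clearDen p α n * F = qFactPoly (p ^ α) (n / p ^ α)) :
    ((A.eval 1 : ℤ) : ℚ) = ((F.eval 1 : ℤ) : ℚ) * ((p : ℚ) ^ l / ((n / p ^ α).factorial : ℚ) *
      ∑ k ∈ lacunary n (p ^ α) r,
        (((c k).eval 1 : ℤ) : ℚ) * (((k : ℚ) - (r : ℚ)) / (p : ℚ) ^ α) ^ l) := by
  have hp0 : (p : ℚ) ≠ 0 := by exact_mod_cast hp.ne_zero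
  have hN : ((n / p ^ α).factorial : ℚ) ≠ 0 := by exact_mod_cast Nat.factorial_ne_zero _
  have h1 := congrArg (fun f => ((eval 1 f : ℤ) : ℚ)) hA
  have h2 := congrArg (fun f => ((eval 1 f : ℤ) : ℚ)) hF
  simp only [eval_mul, eval_finsetSum, eval_pow, Int.cast_mul, Int.cast_sum, Int.cast_pow,
    qFactPoly_eval_one, clearDen_eval_one hp, Int.cast_natCast] at h1 h2
  have h3 : ∀ k ∈ lacunary n (p ^ α) r, (((c k).eval 1 : ℤ) : ℚ) * (((w k).eval 1 : ℤ) : ℚ) ^ l =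
      (p : ℚ) ^ l * ((((c k).eval 1 : ℤ) : ℚ) * (((k : ℚ) - (r : ℚ)) / (p : ℚ) ^ α) ^ l) := by
    intro k hk
    have h4 : (p : ℚ) ^ α * (((w k).eval 1 : ℤ) : ℚ) = p * (k - r) := by exact_mod_cast hw k hk
    have h5 : (((w k).eval 1 : ℤ) : ℚ) = p * (((k : ℚ) - (r : ℚ)) / (p : ℚ) ^ α) := by
      field_simp
      linear_combination h4
    rw [h5, mul_pow]
    ring
  rw [sum_congr rfl h3, ← mul_sum] at h1
  have hpS := pow_ne_zero (∑ j ∈ Icc (α + 1) n, n / p ^ j) hp0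
  apply mul_left_cancel₀ hpS
  rw [h1, ← mul_assoc, h2]
  field_simp

theorem exists_twentyFour_mul {p : ℕ} (hp : p.Prime) (hp5 : 5 ≤ p) :
    ∃ κ : ℤ, 24 * κ = (p : ℤ) ^ 2 - 1 := by
  have h2 : p % 2 = 1 := Nat.odd_iff.1 (odd_of_prime_of_five_le hp hp5)
  have h3 : p % 3 ≠ 0 := fun h => by
    have := (Nat.prime_dvd_prime_iff_eq Nat.prime_three hp).1 (Nat.dvd_of_mod_eq_zero h)
    omega
  have h : p % 24 = 1 ∨ p % 24 = 5 ∨ p % 24 = 7 ∨ p % 24 = 11 ∨ p % 24 = 13 ∨ p % 24 = 17 ∨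
      p % 24 = 19 ∨ p % 24 = 23 := by omega
  have h4 : (p : ℤ) ^ 2 ≡ 1 [ZMOD 24] := by
    have h5 : p ^ 2 % 24 = 1 := by
      rw [Nat.pow_mod]
      rcases h with h | h | h | h | h | h | h | h <;> rw [h]
    have h6 : p ^ 2 ≡ 1 [MOD 24] := h5
    exact_mod_cast (Int.natCast_modEq_iff.2 h6)
  obtain ⟨κ, hκ⟩ := h4.symm.dvd
  exact ⟨κ, hκ.symm⟩

end Bridge

/-! ### The main theorem -/

theorem mainTheorem6 (p : ℕ) (hp : p.Prime) (hp5 : 5 ≤ p) (α : ℕ) (hα : 1 ≤ α)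
    (n l : ℕ) (r : ℤ) :
    -- the q-congruence, with the weights taken to the base q^(p^α) or q^(p^(α+1))
    FracCongr (qIntPoly ℚ p ^ 3) (qLeft p α α n l r) (qRight p α α n l r) ∧
    FracCongr (qIntPoly ℚ p ^ 3) (qLeft p α (α + 1) n l r) (qRight p α (α + 1) n l r) ∧
    -- clearing the factor F(q) in the latter and setting q = 1
    (∃ F A B H : Polynomial ℤ,
      toRatFunc F = clearFactor p α n ∧
      ((F.eval 1 : ℤ) : ℚ) =
        ((n / p ^ α).factorial : ℚ) / (p : ℚ) ^ (∑ j ∈ Finset.Icc (α + 1) n, n / p ^ j) ∧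
      ¬ (p : ℤ) ∣ F.eval 1 ∧
      toRatFunc A =
        qVar ^ (p * l * r.toNat) * (clearFactor p α n * qLeft p α (α + 1) n l r) ∧
      toRatFunc B =
        qVar ^ (p * l * r.toNat) * (clearFactor p α n * qRight p α (α + 1) n l r) ∧
      A - B = qIntPoly ℤ p ^ 3 * H ∧
      ((A.eval 1 : ℤ) : ℚ) = ((F.eval 1 : ℤ) : ℚ) * sdLeft p α n l r ∧
      ((B.eval 1 : ℤ) : ℚ) = ((F.eval 1 : ℤ) : ℚ) * sdRight p α n l r) ∧
    -- the resulting integer congruence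
    FracCongr ((p : ℤ) ^ 3) (sdLeft p α n l r) (sdRight p α n l r) := by
  have := Fact.mk hp
  obtain ⟨κ, hκ⟩ := exists_twentyFour_mul hp hp5
  refine ⟨fracCongr_qLeft_qRight hp hp5 hκ hα α n l r,
    fracCongr_qLeft_qRight hp hp5 hκ hα (α + 1) n l r, ?_⟩
  obtain ⟨F, hF⟩ := clearDen_dvd_qFactPoly hp hp5 α n
  have hw : ∀ k, ∃ w : ℤ[X], k ∈ lacunary n (p ^ α) r →
      (1 - X ^ p ^ α) * w = X ^ (p * r.toNat) - X ^ (p * (-r).toNat) * X ^ (p * k) ∧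
      (p : ℤ) ^ α * w.eval 1 = p * (k - r) ∧
      ∀ l, toRatFuncHom (w ^ l) = qVar ^ (p * l * r.toNat) *
        (qInt (qVar ^ p ^ α) (p : ℤ) ^ l * weight p α (α + 1) l r k) := fun k => by
    by_cases hk : k ∈ lacunary n (p ^ α) r
    · obtain ⟨w, hw⟩ := exists_scaled_weight_numerator hp hk
      exact ⟨w, fun _ => hw⟩
    · exact ⟨0, fun h => absurd h hk⟩
  choose w hw using hw
  obtain ⟨A, hA, hA'⟩ := exists_cleared_weightedSum (l := l) hp (fun k hk => (hw k hk).1)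
    (fun k hk => (hw k hk).2.2) (c := coeffLeft p n)
    (fun j hj i => pow_dvd_sum_coeffLeft hp hp5 (mem_Icc.1 hj).1 n i r)
  obtain ⟨B, hB, hB'⟩ := exists_cleared_weightedSum (l := l) hp (fun k hk => (hw k hk).1)
    (fun k hk => (hw k hk).2.2) (c := coeffRight κ p n)
    (fun j hj i => pow_dvd_sum_coeffRight hp hp5 hα (mem_Icc.1 hj).1 n i r κ)
  -- `clearDen` only involves Φ_{p^j} with j ≥ 2, so the termwise congruence survives division by
  -- it.
  have hAB : cyclotomic p ℤ ^ 3 ∣ A - B := by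
    refine (prime_cyclotomic hp.pos).pow_dvd_of_dvd_mul_left 3 (not_dvd_clearDen hp hα n) ?_
    rw [mul_sub, hA, hB, ← sum_sub_distrib]
    refine Finset.dvd_sum fun k hk => ?_
    rw [← sub_mul]
    exact (dvd_coeffLeft_sub_coeffRight hp hp5 hκ (le_of_mem_lacunary hk)).mul_right _
  obtain ⟨H, hH⟩ := hAB
  have hA1 := eval_one_cleared hp (fun k hk => (hw k hk).2.1) hA hF.symm
  have hB1 := eval_one_cleared hp (fun k hk => (hw k hk).2.1) hB hF.symm
  simp only [coeffLeft_eval_one, coeffRight_eval_one, Int.cast_mul, Int.cast_pow, Int.cast_neg,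
    Int.cast_one, Int.cast_natCast] at hA1 hB1
  rw [← sdLeft] at hA1
  rw [← sdRight] at hB1
  have hF1 := not_dvd_eval_of_mul_clearDen hp hF.symm
  have hF0 : F.eval 1 ≠ 0 := fun h => hF1 (h ▸ dvd_zero _)
  have hF0' : ((F.eval 1 : ℤ) : ℚ) ≠ 0 := by exact_mod_cast hF0
  refine ⟨⟨F, A, B, H, ?_, ?_, hF1, ?_, ?_, ?_, hA1, hB1⟩, A.eval 1, B.eval 1, F.eval 1, hF0,
    ?_, ?_, ?_, ?_⟩
  · rw [toRatFunc_eq, clearFactor_eq hp, hF, map_mul,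
      mul_div_cancel_left₀ _ (toRatFuncHom_ne_zero (clearDen_ne_zero p α n))]
  · have h := congrArg (eval 1) hF
    rw [qFactPoly_eval_one, eval_mul, clearDen_eval_one hp] at h
    have hp0 : (p : ℚ) ≠ 0 := by exact_mod_cast hp.ne_zero
    rw [eq_div_iff (pow_ne_zero _ hp0), mul_comm]
    exact_mod_cast h.symm
  · rw [toRatFunc_eq, hA', qLeft_eq]
  · rw [toRatFunc_eq, hB', qRight_eq hp hκ]
  · rw [hH, cyclotomic_prime, qIntPoly]
  · exact IsCoprime.pow_right
      ((Nat.prime_iff_prime_int.1 hp).irreducible.coprime_iff_not_dvd.2 hF1).symm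
  · rw [eq_div_iff (by simpa using hF0'), mul_comm]; simpa using hA1.symm
  · rw [eq_div_iff (by simpa using hF0'), mul_comm]; simpa using hB1.symm
  -- At q = 1 the factor Φ_p^3 becomes p^3.
  · refine ⟨H.eval 1, ?_⟩
    rw [← eval_sub, hH]
    simp [cyclotomic_prime, eval_finsetSum]
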